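/- Let $a$ and $r$ be integers with $a$ even and $1 \le r < a/2$. For $n \ge 1$ put $$R_n(k) = 2\, n!^{\,a-2r}\Bigl(k+\frac n2\Bigr)\frac{(k-rn)_{rn}\,(k+n+1)_{rn}}{(k)_{n+1}^{\,a}},\qquad S_n(z)=\sum_{k\ge 1} R_n(k)\,z^{-k}\quad(|z|\ge 1),$$ where $(x)_m = x(x+1)\cdots(x+m-1)$, and let $d_n$ be the least common multiple of $1,2,\dots,n$. Then for every $n\ge 1$ the series $S_n(1)$ converges absolutely, and there are rational numbers $\kappa_{0,n}, \kappa_{3,n}, \kappa_{5,n},\dots,\kappa_{a-1,n}$ (for each $n \ge 1$) such that: 1. for every $n\ge1$, $S_n(1) = \kappa_{0,n} + \kappa_{3,n}\,\zeta(3)+\kappa_{5,n}\,\zeta(5)+\cdots+\kappa_{a-1,n}\,\zeta(a-1)$; 2. for every $j\in\{0,3,5,\dots,a-1\}$, $\displaystyle\limsup_{n\to\infty} |\kappa_{j,n}|^{1/n} \le 2^{a-2r}(2r+1)^{2r+1}$; 3. for every $j\in\{0,3,5,\dots,a-1\}$ and every $n\ge 1$, $d_n^{\,a}\,\kappa_{j,n}$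 is an integer; 4. there is a real number $\psi_{r,a}>0$ such that $\displaystyle\lim_{n\to\infty}|S_n(1)|^{1/n}=\psi_{r,a}\le \frac{2^{r+1}}{r^{a-2r}}$. -/

import Mathlib

namespace VeryWellPoised

/-- The rational function
`R_n(x) = 2 n!^(a-2r) (x + n/2) (x-rn)_{rn} (x+n+1)_{rn} / (x)_{n+1}^a`,
where `(x)_m = x (x+1) ⋯ (x+m-1)`; it is used for `2r < a` only. -/
noncomputable def R (a r n : ℕ) (x : ℂ) : ℂ :=
  2 * (n.factorial : ℂ) ^ (a - 2 * r) * (x + (n : ℂ) / 2) *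
    ((ascPochhammer ℂ (r * n)).eval (x - (r : ℂ) * n) *
      (ascPochhammer ℂ (r * n)).eval (x + (n : ℂ) + 1)) /
    ((ascPochhammer ℂ (n + 1)).eval x) ^ a

/-- The term of index `k + 1` of the series `S_n(z)`, namely `R_n(k+1) z^(-(k+1))`. -/
noncomputable def term (a r n : ℕ) (z : ℂ) (k : ℕ) : ℂ :=
  R a r n ((k + 1 : ℕ) : ℂ) * (z ^ (k + 1))⁻¹

/-- The very-well-poised series `S_n(z) = ∑_{k ≥ 1} R_n(k) z^(-k)`. -/
noncomputable def S (a r n : ℕ) (z : ℂ) : ℂ :=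
  ∑' k : ℕ, term a r n z k

/-- `d_n`, the least common multiple of the integers from `1` to `n`. -/
def d (n : ℕ) : ℕ := (Finset.Icc 1 n).lcm id

/-- The odd integers `3, 5, …, a - 1` (for `a` even). -/
def oddIndices (a : ℕ) : Finset ℕ := (Finset.Icc 3 (a - 1)).filter (fun j => j % 2 = 1)

end VeryWellPoised

namespace VeryWellPoised

open Finset Filter Topology
open scoped Polynomial PowerSeries

/-! The numerator of `R_n` has degree at least two below its denominator, so `R_n` is a sum of terms
`c_{i,j} / (x + j) ^ i` with `1 ≤ i ≤ a`, `0 ≤ j ≤ n` (`R_eq_sum`). Summing over `k` turns each term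
into `c_{i,j}` times `ζ(i)` minus a truncated harmonic sum. The residues `c_{1,j}` sum to zero by
the degree gap (`sum_coef_one`), and the symmetry `R_n(-n - x) = -R_n(x)`, which needs `a` even,
cancels the even `i` (`sum_coef_eq_zero_of_even`). Only `1` and the odd zeta values from `ζ(3)` on
survive (`S_eq_of_summable`).

The `c_{i,j}` are Taylor coefficients of `t ^ a * R_n(t - j)`, handled as a formal power series over
`ℚ`. This series is an integral linear factor times `a` blocks, each with numerator of degree at
most `n` and integer residues; a block lies in the ring of series `f` with `f (d_n t)` integral
(`poleSeries_mem_integralSeries`), which gives the denominators. For the growth, a submultiplicative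
weighted sum of absolute coefficients plays the part of Cauchy's estimate on `|t| = 1/2`, and what
remains is a quotient of factorials bounded by binomial and multinomial coefficients
(`factorial_quotient_le`).

The terms `R_n(k)` vanish for `k ≤ rn` and are positive afterwards, so `S_n(1)` has no cancellation
and its growth is that of its largest term. A crude Stirling estimate gives `R_n(k) = exp (n * rate
(k / n))` up to polynomial factors, and the limit of the roots is the exponential of the maximum of
`rate` (`tendsto_root_norm_S`). Its upper bound comes from the elementary estimate `realTerm_le`. -/

/-- The expansion of `1 / (t + b)` in powers of `t`. -/
noncomputable def geom (b : ℚ) : ℚ⟦X⟧ := PowerSeries.mk fun m => (-1) ^ m / b ^ (m + 1)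

theorem X_add_C_mul_geom {b : ℚ} (hb : b ≠ 0) :
    ((PowerSeries.X : ℚ⟦X⟧) + PowerSeries.C b) * geom b = 1 := by
  ext m
  rw [add_mul, map_add, PowerSeries.coeff_C_mul]
  cases m with
  | zero => simp [geom, hb]
  | succ m =>
    rw [PowerSeries.coeff_succ_X_mul, PowerSeries.coeff_one]
    simp only [geom, PowerSeries.coeff_mk, Nat.add_eq_zero_iff, one_ne_zero, and_false, if_false]
    field_simp
    ring

/-! ### Partial fractions from local power series -/

section PartialFractions

variable {ι : Type*} [DecidableEq ι] (s : Finset ι) (v : ι → ℚ)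

/-- The expansion of `∏_{h ≠ j} 1 / (x - v h)` in powers of `x - v j`. -/
noncomputable def cofactor (j : ι) : ℚ⟦X⟧ := ∏ h ∈ s.erase j, geom (v j - v h)

/-- The expansion of `p / ∏_{h ≠ j} (x - v h) ^ a` in powers of `x - v j`. -/
noncomputable def localSeries (a : ℕ) (p : ℚ[X]) (j : ι) : ℚ⟦X⟧ :=
  (p.comp (Polynomial.X + Polynomial.C (v j)) : ℚ[X]) * cofactor s v j ^ a

variable {s v}

theorem prod_mul_cofactor (hv : Set.InjOn v s) {j : ι} (hj : j ∈ s) :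
    (∏ h ∈ s.erase j, ((PowerSeries.X : ℚ⟦X⟧) + PowerSeries.C (v j - v h))) * cofactor s v j
      = 1 := by
  rw [cofactor, ← prod_mul_distrib]
  refine prod_eq_one fun h hh => X_add_C_mul_geom ?_
  rw [mem_erase] at hh
  exact sub_ne_zero.2 fun e => hh.1 (hv hh.2 hj e.symm)

/-- Partial fraction decomposition with respect to `∏ (x - v j) ^ a`, cleared of denominators. -/
theorem eq_sum_localSeries (hv : Set.InjOn v s) (a : ℕ) (p : ℚ[X])
    (hp : p.degree < (a * #s : ℕ)) :
    p = ∑ j ∈ s, (PowerSeries.trunc a (localSeries s v a p j)).comp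
        (Polynomial.X - Polynomial.C (v j)) *
      ∏ h ∈ s.erase j, (Polynomial.X - Polynomial.C (v h)) ^ a := by
  set q : ι → ℚ[X] := fun j => (PowerSeries.trunc a (localSeries s v a p j)).comp
        (Polynomial.X - Polynomial.C (v j)) *
      ∏ h ∈ s.erase j, (Polynomial.X - Polynomial.C (v h)) ^ a with hq
  -- At `v j` the summand `q j` agrees with `p` to order `a`, and every other summand carries the
  -- factor `(X - v j) ^ a`. These powers are coprime and their product has degree `a * #s`, too
  -- large to divide a nonzero difference.
  have hdiv : ∀ j ∈ s, (Polynomial.X - Polynomial.C (v j)) ^ a ∣ p - ∑ j ∈ s, q j := by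
    intro j hj
    rw [← add_sum_erase _ _ hj, ← sub_sub]
    refine dvd_sub ?_ (dvd_sum fun h hh => ?_)
    · rw [Polynomial.X_sub_C_pow_dvd_iff, Polynomial.X_pow_dvd_iff]
      have key : (PowerSeries.X : ℚ⟦X⟧) ^ a ∣
          (((p - q j).comp (Polynomial.X + Polynomial.C (v j)) : ℚ[X]) : ℚ⟦X⟧) := by
        set W : ℚ⟦X⟧ :=
          ∏ h ∈ s.erase j, ((PowerSeries.X : ℚ⟦X⟧) + PowerSeries.C (v j - v h)) with hW
        have h1 : W ^ a * cofactor s v j ^ a = 1 := by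
          rw [← mul_pow, prod_mul_cofactor hv hj, one_pow]
        have h2 : (((q j).comp (Polynomial.X + Polynomial.C (v j)) : ℚ[X]) : ℚ⟦X⟧) =
            (PowerSeries.trunc a (localSeries s v a p j) : ℚ[X]) * W ^ a := by
          simp only [hq, Polynomial.mul_comp, Polynomial.comp_assoc, Polynomial.prod_comp,
            Polynomial.sub_comp, Polynomial.pow_comp, Polynomial.X_comp, Polynomial.C_comp,
            add_sub_cancel_right, Polynomial.comp_X, Polynomial.coe_mul]
          congr 1
          rw [hW, ← prod_pow, ← Polynomial.coeToPowerSeries.ringHom_apply, map_prod]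
          refine prod_congr rfl fun h _ => ?_
          simp only [Polynomial.coeToPowerSeries.ringHom_apply, Polynomial.coe_pow,
            Polynomial.coe_sub, Polynomial.coe_add, Polynomial.coe_X, Polynomial.coe_C, map_sub]
          ring
        have h3 : ((p.comp (Polynomial.X + Polynomial.C (v j)) : ℚ[X]) : ℚ⟦X⟧) =
            localSeries s v a p j * W ^ a := by
          rw [localSeries, mul_assoc, mul_comm (cofactor s v j ^ a), h1, mul_one]
        rw [Polynomial.sub_comp, Polynomial.coe_sub, h2, h3, ← sub_mul]
        refine Dvd.dvd.mul_right ?_ _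
        rw [PowerSeries.X_pow_dvd_iff]
        intro m hm
        rw [map_sub, Polynomial.coeff_coe, PowerSeries.coeff_trunc, if_pos hm, sub_self]
      rw [PowerSeries.X_pow_dvd_iff] at key
      intro m hm
      rw [← Polynomial.coeff_coe, key m hm]
    · refine Dvd.dvd.mul_left ?_ _
      exact dvd_prod_of_mem (fun h => (Polynomial.X - Polynomial.C (v h)) ^ a)
        (mem_erase.2 ⟨(mem_erase.1 hh).1.symm, hj⟩)
  have hprod : ∏ j ∈ s, (Polynomial.X - Polynomial.C (v j)) ^ a ∣ p - ∑ j ∈ s, q j := by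
    refine Finset.prod_dvd_of_coprime (fun i hi j hj hij => ?_) hdiv
    exact (Polynomial.isCoprime_X_sub_C_of_isUnit_sub
      (sub_ne_zero.2 fun e => hij (hv hi hj e)).isUnit).pow
  have hdegprod : ∀ u : Finset ι,
      (∏ j ∈ u, (Polynomial.X - Polynomial.C (v j)) ^ a).degree = ((a * #u : ℕ) : WithBot ℕ) := by
    intro u
    rw [Polynomial.degree_prod]
    simp [Polynomial.degree_pow, mul_comm]
  have hdq : ∀ j ∈ s, (q j).degree < (a * #s : ℕ) := by
    intro j hj
    rw [hq]
    rcases eq_or_ne (PowerSeries.trunc a (localSeries s v a p j)) 0 with h0 | h0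
    · simp only [h0, Polynomial.zero_comp, zero_mul, Polynomial.degree_zero]
      exact WithBot.bot_lt_coe _
    have h1 := PowerSeries.degree_trunc_lt (localSeries s v a p j) a
    rw [Polynomial.degree_mul, hdegprod, Polynomial.degree_eq_natDegree (by
      intro h
      rw [Polynomial.comp_eq_zero_iff] at h
      rcases h with h | h
      · exact h0 h
      · have := congrArg (fun f => Polynomial.coeff f 1) h.2
        simp [Polynomial.coeff_X] at this), Polynomial.natDegree_comp,
      Polynomial.natDegree_X_sub_C, mul_one]
    rw [Polynomial.degree_eq_natDegree h0] at h1
    have h2 : (PowerSeries.trunc a (localSeries s v a p j)).natDegree < a := by exact_mod_cast h1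
    rw [card_erase_of_mem hj]
    have h3 : 0 < #s := card_pos.2 ⟨j, hj⟩
    obtain ⟨c, hc⟩ : ∃ c, #s = c + 1 := ⟨#s - 1, by omega⟩
    rw [hc, Nat.add_sub_cancel]
    norm_cast
    rw [mul_add]
    omega
  have hdeg : (p - ∑ j ∈ s, q j).degree < (a * #s : ℕ) := by
    refine lt_of_le_of_lt (Polynomial.degree_sub_le _ _) (max_lt hp ?_)
    refine lt_of_le_of_lt (Polynomial.degree_sum_le _ _) ?_
    exact (Finset.sup_lt_iff (WithBot.bot_lt_coe _)).2 hdq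
  refine sub_eq_zero.1 (Polynomial.eq_zero_of_dvd_of_degree_lt hprod ?_)
  rw [hdegprod]
  exact hdeg

end PartialFractions

/-! ### Power series with controlled denominators -/

section Integrality

/-- The power series `f` over `ℚ` for which `f (d t)` has integer coefficients. -/
noncomputable def integralSeries (d : ℕ) : Subring ℚ⟦X⟧ :=
  (PowerSeries.map (Int.castRingHom ℚ)).range.comap (PowerSeries.rescale (d : ℚ))

theorem mem_integralSeries {d : ℕ} {f : ℚ⟦X⟧} :
    f ∈ integralSeries d ↔ ∀ m, ∃ z : ℤ, (d : ℚ) ^ m * PowerSeries.coeff m f = z := by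
  rw [integralSeries, Subring.mem_comap, RingHom.mem_range]
  constructor
  · rintro ⟨g, hg⟩ m
    refine ⟨PowerSeries.coeff m g, ?_⟩
    rw [← PowerSeries.coeff_rescale, ← hg]
    simp
  · intro h
    choose z hz using h
    refine ⟨PowerSeries.mk z, ?_⟩
    ext m
    simp [hz]

theorem C_mem_integralSeries (d : ℕ) (z : ℤ) : PowerSeries.C (z : ℚ) ∈ integralSeries d := by
  have : PowerSeries.C (z : ℚ) = ((z : ℤ) : ℚ⟦X⟧) := by simp
  rw [this]
  exact intCast_mem _ z

theorem X_mem_integralSeries (d : ℕ) : (PowerSeries.X : ℚ⟦X⟧) ∈ integralSeries d := by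
  rw [mem_integralSeries]
  intro m
  rw [PowerSeries.coeff_X]
  split_ifs
  · exact ⟨(d : ℤ) ^ m, by push_cast; ring⟩
  · exact ⟨0, by simp⟩

/-- The factor `X` is essential: it aligns the power `b ^ (m + 1)` in the denominator with `d ^ (m +
1)`, whereas `geom b` alone is one factor of `d` short. -/
theorem X_mul_geom_mem_integralSeries {d : ℕ} {b : ℤ} (hb : b ≠ 0) (hbd : b ∣ d) :
    PowerSeries.X * geom b ∈ integralSeries d := by
  rw [mem_integralSeries]
  intro m
  cases m with
  | zero => exact ⟨0, by simp⟩
  | succ m =>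
    obtain ⟨e, he⟩ := hbd
    refine ⟨(-1) ^ m * e ^ (m + 1), ?_⟩
    have he' : (d : ℚ) = b * e := by exact_mod_cast he
    have hb' : (b : ℚ) ≠ 0 := by exact_mod_cast hb
    rw [PowerSeries.coeff_succ_X_mul, geom, PowerSeries.coeff_mk, he', mul_pow]
    push_cast
    field_simp

variable {ι : Type*} [DecidableEq ι] {s : Finset ι} {v : ι → ℤ}

/-- A polynomial whose residues `p (v j) / ∏ (v j - v h)` are integers has local expansions of
controlled denominator. -/
theorem comp_mul_cofactor_mem_integralSeries (hv : Set.InjOn v s) {d : ℕ}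
    (hd : ∀ i ∈ s, ∀ j ∈ s, v i - v j ∣ d ∨ i = j) {p : ℚ[X]}
    (hp : p.degree < (#s : ℕ))
    (hres : ∀ j ∈ s, ∃ z : ℤ, p.eval (v j : ℚ) = z * ∏ h ∈ s.erase j, ((v j : ℚ) - v h))
    {j : ι} (hj : j ∈ s) :
    (p.comp (Polynomial.X + Polynomial.C (v j : ℚ)) : ℚ[X]) * cofactor s (fun i => (v i : ℚ)) j
      ∈ integralSeries d := by
  set w : ι → ℚ := fun i => (v i : ℚ) with hw
  have hwi : Set.InjOn w s := fun i hi j hj e => hv hi hj (by simpa [hw] using e)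
  have hcoef : ∀ i ∈ s, ∃ z : ℤ, PowerSeries.trunc 1 (localSeries s w 1 p i) =
      Polynomial.C (z : ℚ) := by
    intro i hi
    obtain ⟨z, hz⟩ := hres i hi
    refine ⟨z, ?_⟩
    ext m
    rw [PowerSeries.coeff_trunc, Polynomial.coeff_C]
    rcases Nat.eq_zero_or_pos m with rfl | hm
    · rw [if_pos one_pos, if_pos rfl]
      have h1 := congrArg (PowerSeries.coeff 0) (prod_mul_cofactor hwi hi)
      rw [PowerSeries.coeff_zero_eq_constantCoeff_apply, map_mul, map_prod] at h1
      simp only [map_add, PowerSeries.constantCoeff_X, zero_add,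
        PowerSeries.constantCoeff_C, PowerSeries.coeff_zero_one] at h1
      rw [PowerSeries.coeff_zero_eq_constantCoeff_apply, localSeries, pow_one, map_mul,
        ← PowerSeries.coeff_zero_eq_constantCoeff_apply, Polynomial.coeff_coe,
        Polynomial.coeff_zero_eq_eval_zero, Polynomial.eval_comp]
      simp only [Polynomial.eval_add, Polynomial.eval_X, Polynomial.eval_C, zero_add]
      rw [hw] at h1 ⊢
      simp only at h1 ⊢
      rw [hz, mul_assoc, h1, mul_one]
    · rw [if_neg (by omega), if_neg (by omega)]
  -- With simple poles, `p` is a sum of integers `z i` times `∏_{h ≠ i} (x - v h)`. After division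
  -- by `∏_{h ≠ j} (x - v h)`, the term `i = j` is an integer and any other term is `z i * t / (t +
  -- v j - v i)`.
  have hdec := eq_sum_localSeries hwi 1 p (by simpa using hp)
  rw [hdec, ← Polynomial.coe_compRingHom_apply, map_sum, ← Polynomial.coeToPowerSeries.ringHom_apply,
    map_sum, sum_mul]
  refine sum_mem fun i hi => ?_
  obtain ⟨z, hz⟩ := hcoef i hi
  rw [hz]
  simp only [Polynomial.coe_compRingHom_apply, Polynomial.C_comp, pow_one, Polynomial.X_comp, map_mul, map_prod, map_sub,
    map_add, Polynomial.coeToPowerSeries.ringHom_apply, Polynomial.coe_C, Polynomial.coe_X]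
  rw [mul_assoc]
  refine mul_mem (C_mem_integralSeries d z) ?_
  have hlin : ∀ h, (PowerSeries.X : ℚ⟦X⟧) + PowerSeries.C (v j : ℚ) - PowerSeries.C (w h) =
      PowerSeries.X + PowerSeries.C (w j - w h) := by
    intro h
    rw [map_sub]
    ring
  simp only [hlin]
  rcases eq_or_ne i j with rfl | hij
  · rw [prod_mul_cofactor hwi hi]
    exact one_mem _
  · have hj' : j ∈ s.erase i := mem_erase.2 ⟨hij.symm, hj⟩
    have hi' : i ∈ s.erase j := mem_erase.2 ⟨hij, hi⟩
    have hcomm : (s.erase i).erase j = (s.erase j).erase i := erase_right_comm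
    rw [cofactor, ← mul_prod_erase _ _ hj', ← mul_prod_erase _ _ hi', hcomm]
    have h1 : (∏ h ∈ (s.erase j).erase i, ((PowerSeries.X : ℚ⟦X⟧) + PowerSeries.C (w j - w h))) *
        ∏ h ∈ (s.erase j).erase i, geom (w j - w h) = 1 := by
      rw [← prod_mul_distrib]
      refine prod_eq_one fun h hh => X_add_C_mul_geom ?_
      simp only [mem_erase] at hh
      exact sub_ne_zero.2 fun e => hh.2.1 (hwi hh.2.2 hj e.symm)
    rw [sub_self, map_zero, add_zero]
    have h2 : PowerSeries.X * geom (w j - w i) ∈ integralSeries d := by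
      have h3 : w j - w i = ((v j - v i : ℤ) : ℚ) := by push_cast; rfl
      rw [h3]
      refine X_mul_geom_mem_integralSeries (sub_ne_zero.2 fun e => hij (hv hi hj e.symm)) ?_
      exact (hd j hj i hi).resolve_right hij.symm
    convert h2 using 1
    linear_combination (PowerSeries.X * geom (w j - w i)) * h1

end Integrality

/-! ### A submultiplicative norm on power series -/

section Majorant

/-- The sum of the `|coeff m f| 2⁻ᵐ` is at most `B`. -/
def NormLE (f : ℚ⟦X⟧) (B : ℝ) : Prop :=
  ∀ N, ∑ m ∈ range N, |((PowerSeries.coeff m f : ℚ) : ℝ)| * (1 / 2) ^ m ≤ B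

theorem NormLE.nonneg {f : ℚ⟦X⟧} {B : ℝ} (h : NormLE f B) : 0 ≤ B := by simpa using h 0

theorem NormLE.mono {f : ℚ⟦X⟧} {B B' : ℝ} (h : NormLE f B) (hB : B ≤ B') : NormLE f B' :=
  fun N => (h N).trans hB

theorem NormLE.abs_coeff_le {f : ℚ⟦X⟧} {B : ℝ} (h : NormLE f B) (m : ℕ) :
    |((PowerSeries.coeff m f : ℚ) : ℝ)| ≤ 2 ^ m * B := by
  have h1 := (single_le_sum (f := fun m => |((PowerSeries.coeff m f : ℚ) : ℝ)| * (1 / 2) ^ m)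
    (fun i _ => by positivity) (self_mem_range_succ m)).trans (h (m + 1))
  have h2 : |((PowerSeries.coeff m f : ℚ) : ℝ)| =
      2 ^ m * (|((PowerSeries.coeff m f : ℚ) : ℝ)| * (1 / 2) ^ m) := by
    rw [mul_left_comm, ← mul_pow]
    norm_num
  rw [h2]
  gcongr

/-- The pairs of indices with sum below `N` form a triangle inside the square `range N ×ˢ range N`,
and the sum over the square factors. -/
theorem NormLE.mul {f g : ℚ⟦X⟧} {A B : ℝ} (hf : NormLE f A) (hg : NormLE g B) :
    NormLE (f * g) (A * B) := by
  intro N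
  set F : ℕ → ℝ := fun m => |((PowerSeries.coeff m f : ℚ) : ℝ)| * (1 / 2) ^ m
  set G : ℕ → ℝ := fun m => |((PowerSeries.coeff m g : ℚ) : ℝ)| * (1 / 2) ^ m
  have h1 : ∀ m, |((PowerSeries.coeff m (f * g) : ℚ) : ℝ)| * (1 / 2) ^ m ≤
      ∑ x ∈ antidiagonal m, F x.1 * G x.2 := by
    intro m
    rw [PowerSeries.coeff_mul, Rat.cast_sum]
    calc _ ≤ (∑ x ∈ antidiagonal m, |((PowerSeries.coeff x.1 f * PowerSeries.coeff x.2 g : ℚ) : ℝ)|)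
          * (1 / 2) ^ m := by gcongr; exact abs_sum_le_sum_abs _ _
      _ = _ := by
        rw [sum_mul]
        refine sum_congr rfl fun x hx => ?_
        rw [← HasAntidiagonal.mem_antidiagonal.1 hx, pow_add]
        push_cast
        rw [abs_mul]
        simp only [F, G]
        ring
  calc _ ≤ ∑ m ∈ range N, ∑ x ∈ antidiagonal m, F x.1 * G x.2 := sum_le_sum fun m _ => h1 m
    _ ≤ ∑ x ∈ range N ×ˢ range N, F x.1 * G x.2 := by
        rw [← sum_biUnion]
        · refine sum_le_sum_of_subset_of_nonneg ?_ fun x _ _ => by positivity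
          intro x hx
          simp only [mem_biUnion, mem_range, HasAntidiagonal.mem_antidiagonal] at hx
          obtain ⟨m, hm, hx⟩ := hx
          simp only [mem_product, mem_range]
          omega
        · intro i _ j _ hij
          refine disjoint_left.2 fun x hx hx' => hij ?_
          rw [HasAntidiagonal.mem_antidiagonal] at hx hx'
          omega
    _ = (∑ m ∈ range N, F m) * ∑ m ∈ range N, G m := by rw [sum_mul_sum, sum_product]
    _ ≤ A * B := mul_le_mul (hf N) (hg N) (sum_nonneg fun _ _ => by positivity) hf.nonneg

theorem normLE_C (c : ℚ) : NormLE (PowerSeries.C c) |(c : ℝ)| := by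
  intro N
  rcases N with _ | N
  · simp
  · rw [sum_range_succ']
    simp [PowerSeries.coeff_C]

theorem NormLE.prod {ι : Type*} {s : Finset ι} {f : ι → ℚ⟦X⟧} {B : ι → ℝ}
    (h : ∀ i ∈ s, NormLE (f i) (B i)) : NormLE (∏ i ∈ s, f i) (∏ i ∈ s, B i) := by
  classical
  induction s using Finset.induction_on with
  | empty => simpa using normLE_C 1
  | insert i s hi ih =>
    rw [prod_insert hi, prod_insert hi]
    exact (h i (mem_insert_self _ _)).mul (ih fun j hj => h j (mem_insert_of_mem hj))

theorem NormLE.pow {f : ℚ⟦X⟧} {B : ℝ} (h : NormLE f B) (a : ℕ) : NormLE (f ^ a) (B ^ a) := by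
  have := NormLE.prod (s := range a) (fun _ _ => h)
  simpa using this

theorem NormLE.add {f g : ℚ⟦X⟧} {A B : ℝ} (hf : NormLE f A) (hg : NormLE g B) :
    NormLE (f + g) (A + B) := by
  intro N
  refine le_trans ?_ (add_le_add (hf N) (hg N))
  rw [← sum_add_distrib]
  refine sum_le_sum fun m _ => ?_
  rw [← add_mul, map_add, Rat.cast_add]
  gcongr
  exact abs_add_le _ _

theorem normLE_X : NormLE PowerSeries.X (1 / 2) := by
  intro N
  rcases N with _ | _ | N
  · simp
  · simp
  · rw [sum_range_succ', sum_range_succ']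
    simp [PowerSeries.coeff_X]

/-- The radius `1/2` stays inside the disc of convergence because distinct poles are at distance at
least `1`; the bound is the sum of the geometric series. -/
theorem normLE_geom {b : ℚ} (hb : 1 ≤ |b|) : NormLE (geom b) (1 / (|(b : ℝ)| - 1 / 2)) := by
  intro N
  have hb' : (1 : ℝ) ≤ |(b : ℝ)| := by exact_mod_cast hb
  set c := |(b : ℝ)|
  have h1 : ∀ m, |((PowerSeries.coeff m (geom b) : ℚ) : ℝ)| * (1 / 2) ^ m = 1 / c * (1 / (2 * c)) ^ m := by
    intro m
    rw [geom, PowerSeries.coeff_mk]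
    push_cast
    rw [abs_div, abs_pow, abs_pow, abs_neg, abs_one, one_pow, pow_succ]
    change 1 / (c ^ m * c) * (1 / 2) ^ m = _
    simp only [div_pow, one_pow, mul_pow]
    field_simp
  simp only [h1]
  rw [← mul_sum]
  have h2 : 1 / (2 * c) < 1 := by rw [div_lt_one (by linarith)]; linarith
  have h3 := (summable_geometric_of_lt_one (by positivity) h2).sum_le_tsum (range N)
    (fun _ _ => by positivity)
  rw [tsum_geometric_of_lt_one (by positivity) h2] at h3
  calc _ ≤ 1 / c * (1 - 1 / (2 * c))⁻¹ := by gcongr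
    _ = _ := by
      rw [one_div, one_div (c - 1 / 2), ← mul_inv]
      congr 1
      field_simp

end Majorant

/-! ### Local expansions at the poles -/

/-- The poles `0, -1, -2, …` of `R`. -/
def node (j : ℕ) : ℤ := -j

/-- The numerator of `R`. -/
noncomputable def numer (a r n : ℕ) : ℚ[X] :=
  Polynomial.C ((n.factorial : ℚ) ^ (a - 2 * r)) *
    (Polynomial.C 2 * Polynomial.X + Polynomial.C (n : ℚ)) *
    (∏ i ∈ range (r * n), (Polynomial.X - Polynomial.C ((i + 1 : ℕ) : ℚ))) *
    ∏ i ∈ range (r * n), (Polynomial.X + Polynomial.C ((n + 1 + i : ℕ) : ℚ))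

/-- The expansion of `t ^ a * R (t - j)` in powers of `t`. -/
noncomputable def poleSeries (a r n j : ℕ) : ℚ⟦X⟧ :=
  localSeries (range (n + 1)) (fun i => (node i : ℚ)) a (numer a r n) j

theorem node_injective : Function.Injective node := fun i j h => by simpa [node] using h

theorem coe_X_add_C_comp (b c : ℚ) :
    (((Polynomial.X + Polynomial.C b).comp (Polynomial.X + Polynomial.C c) : ℚ[X]) : ℚ⟦X⟧) =
      PowerSeries.X + PowerSeries.C (b + c) := by
  simp only [Polynomial.add_comp, Polynomial.X_comp, Polynomial.C_comp, Polynomial.coe_add,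
    Polynomial.coe_X, Polynomial.coe_C, map_add]
  ring

theorem coe_prod_comp (s : Finset ℕ) (p : ℕ → ℚ[X]) (c : ℚ) :
    (((∏ i ∈ s, p i).comp (Polynomial.X + Polynomial.C c) : ℚ[X]) : ℚ⟦X⟧) =
      ∏ i ∈ s, (((p i).comp (Polynomial.X + Polynomial.C c) : ℚ[X]) : ℚ⟦X⟧) := by
  rw [Polynomial.prod_comp, ← Polynomial.coeToPowerSeries.ringHom_apply, map_prod]
  rfl

theorem poleSeries_eq (a r n j : ℕ) :
    poleSeries a r n j =
      PowerSeries.C ((n.factorial : ℚ) ^ (a - 2 * r)) *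
      (PowerSeries.C 2 * PowerSeries.X + PowerSeries.C ((n : ℚ) - 2 * j)) *
      (∏ i ∈ range (r * n), (PowerSeries.X + PowerSeries.C (-((j + i + 1 : ℕ) : ℚ)))) *
      (∏ i ∈ range (r * n), (PowerSeries.X + PowerSeries.C (((n + 1 + i : ℕ) : ℚ) - j))) *
      cofactor (range (n + 1)) (fun i => (node i : ℚ)) j ^ a := by
  rw [poleSeries, localSeries, numer]
  congr 1
  simp only [Polynomial.mul_comp, Polynomial.coe_mul, coe_prod_comp, Polynomial.C_comp,
    Polynomial.coe_C, sub_eq_add_neg (Polynomial.X : ℚ[X]), ← Polynomial.C_neg, coe_X_add_C_comp]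
  congr 1
  · congr 1
    · congr 1
      simp only [Polynomial.add_comp, Polynomial.mul_comp, Polynomial.C_comp, Polynomial.X_comp,
        Polynomial.coe_add, Polynomial.coe_mul, Polynomial.coe_C, Polynomial.coe_X, node]
      rw [mul_add, add_assoc, ← map_mul, ← map_add]
      congr 2
      push_cast
      ring
    · refine prod_congr rfl fun i _ => ?_
      congr 2
      simp [node]
      ring
  · refine prod_congr rfl fun i _ => ?_
    congr 2
    simp [node]
    ring

/-- Both halves are indexed so that `i + 1` is the distance from `j`, which makes factorials appear
on each side. -/
theorem prod_range_erase {M : Type*} [CommMonoid M] (f : ℕ → M) {n j : ℕ} (hj : j ≤ n) :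
    ∏ h ∈ (range (n + 1)).erase j, f h =
      (∏ i ∈ range j, f (j - 1 - i)) * ∏ i ∈ range (n - j), f (j + 1 + i) := by
  rw [prod_range_reflect f j]
  obtain ⟨k, rfl⟩ := Nat.exists_eq_add_of_le hj
  rw [Nat.add_sub_cancel_left]
  have h1 : (range (j + k + 1)).erase j = range j ∪ (range k).image (fun i => j + 1 + i) := by
    ext i
    simp only [mem_erase, mem_range, mem_union, mem_image]
    constructor
    · intro h
      rcases lt_or_ge i j with h' | h'
      · exact Or.inl h'
      · exact Or.inr ⟨i - (j + 1), by omega, by omega⟩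
    · rintro (h | ⟨i, hi, rfl⟩) <;> omega
  rw [h1, prod_union, prod_image]
  · intro x _ y _ h
    exact Nat.add_left_cancel h
  · refine disjoint_left.2 fun i hi hi' => ?_
    simp only [mem_range, mem_image] at hi hi'
    obtain ⟨x, _, rfl⟩ := hi'
    omega

theorem cast_sub_one_sub {j i : ℕ} (h : i < j) : ((j - 1 - i : ℕ) : ℚ) = j - (i + 1) := by
  have : j - 1 - i + (i + 1) = j := by omega
  have h2 : ((j - 1 - i : ℕ) : ℚ) + (i + 1) = j := by exact_mod_cast this
  linarith

theorem prod_node_sub {n j : ℕ} (hj : j ≤ n) :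
    ∏ h ∈ (range (n + 1)).erase j, ((node j : ℚ) - node h) =
      (-1) ^ j * (j.factorial * (n - j).factorial : ℕ) := by
  rw [prod_range_erase _ hj]
  have h1 : ∏ i ∈ range j, ((node j : ℚ) - node (j - 1 - i)) = ∏ i ∈ range j, (-1 * ((i + 1 : ℕ) : ℚ)) := by
    refine prod_congr rfl fun i hi => ?_
    simp only [node, Int.cast_neg, Int.cast_natCast]
    rw [cast_sub_one_sub (mem_range.1 hi)]
    push_cast
    ring
  have h2 : ∏ i ∈ range (n - j), ((node j : ℚ) - node (j + 1 + i)) =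
      ∏ i ∈ range (n - j), ((i + 1 : ℕ) : ℚ) := by
    refine prod_congr rfl fun i _ => ?_
    simp only [node, Int.cast_neg, Int.cast_natCast]
    push_cast
    ring
  rw [h1, h2, prod_mul_distrib, prod_const, card_range, ← Nat.cast_prod, ← Nat.cast_prod,
    prod_range_add_one_eq_factorial, prod_range_add_one_eq_factorial]
  push_cast
  ring

/-! ### Denominators of the coefficients -/

/-- A polynomial of degree at most `n` taking values divisible by `n!` at the poles. -/
theorem block_mem_integralSeries {n j : ℕ} (hj : j ≤ n) {p : ℚ[X]} (hp : p.degree ≤ n)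
    (hval : ∀ i ≤ n, ∃ z : ℤ, p.eval (node i : ℚ) = z * n.factorial) :
    (p.comp (Polynomial.X + Polynomial.C (node j : ℚ)) : ℚ[X]) *
      cofactor (range (n + 1)) (fun i => (node i : ℚ)) j ∈ integralSeries (d n) := by
  refine comp_mul_cofactor_mem_integralSeries node_injective.injOn ?_ ?_ ?_
    (mem_range.2 (Nat.lt_succ_of_le hj))
  · intro i hi k hk
    rw [mem_range] at hi hk
    rcases eq_or_ne i k with h | h
    · exact Or.inr h
    · have h1 : 1 ≤ (node i - node k).natAbs := by simp only [node]; omega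
      have h2 : (node i - node k).natAbs ≤ n := by simp only [node]; omega
      refine Or.inl (Int.natAbs_dvd.1 (Int.natCast_dvd_natCast.2 ?_))
      exact Finset.dvd_lcm (f := id) (mem_Icc.2 ⟨h1, h2⟩)
  · rw [card_range]
    refine lt_of_le_of_lt hp ?_
    exact_mod_cast Nat.lt_succ_self n
  · intro i hi
    have hi' : i ≤ n := Nat.lt_succ_iff.1 (mem_range.1 hi)
    obtain ⟨z, hz⟩ := hval i hi'
    -- The residue is `z * n!` divided by `(-1) ^ i * i! * (n - i)!`.
    refine ⟨z * (-1) ^ i * n.choose i, ?_⟩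
    rw [hz, prod_node_sub hi', ← Nat.choose_mul_factorial_mul_factorial hi']
    have : ((-1 : ℚ) ^ i) * (-1) ^ i = 1 := by rw [← mul_pow]; norm_num
    push_cast
    linear_combination -(z * (n.choose i * i.factorial * (n - i).factorial : ℚ)) * this

theorem degree_prod_linear_le (n : ℕ) (f : ℕ → ℚ[X]) (h : ∀ i, (f i).degree ≤ 1) :
    (∏ i ∈ range n, f i).degree ≤ n := by
  refine (Polynomial.degree_prod_le _ _).trans ((sum_le_sum fun i _ => h i).trans ?_)
  simp

theorem prod_range_mul' {M : Type*} [CommMonoid M] (f : ℕ → M) (r n : ℕ) :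
    ∏ i ∈ range (r * n), f i = ∏ l ∈ range r, ∏ i ∈ range n, f (l * n + i) := by
  induction r with
  | zero => simp
  | succ r ih => rw [Nat.succ_mul, prod_range_add, ih, prod_range_succ]

/-- The `a` copies of the cofactor are shared out: `a - 2r` go with a constant `n!`, and `2r` with
blocks of `n` consecutive linear factors, `r` on each side of the poles. A block takes at each pole,
up to sign, the value of a product of `n` consecutive positive integers, divisible by `n!`. -/
theorem poleSeries_mem_integralSeries {a r n j : ℕ} (hra : 2 * r < a) (hj : j ≤ n) :
    poleSeries a r n j ∈ integralSeries (d n) := by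
  set D := integralSeries (d n)
  set U := cofactor (range (n + 1)) (fun i => (node i : ℚ)) j
  set c : ℚ := (node j : ℚ)
  have hfac : ((Polynomial.C (n.factorial : ℚ)).comp (Polynomial.X + Polynomial.C c) : ℚ[X]) * U
      ∈ D := by
    refine block_mem_integralSeries hj (Polynomial.degree_C_le.trans (by positivity)) ?_
    intro i _
    exact ⟨1, by simp⟩
  have hleft : ∀ l, ((∏ i ∈ range n, (Polynomial.X - Polynomial.C ((l * n + i + 1 : ℕ) : ℚ))).comp
      (Polynomial.X + Polynomial.C c) : ℚ[X]) * U ∈ D := by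
    intro l
    refine block_mem_integralSeries hj (degree_prod_linear_le _ _ fun i =>
      (Polynomial.degree_X_sub_C _).le) ?_
    intro i _
    obtain ⟨z, hz⟩ := Nat.factorial_dvd_ascFactorial (i + l * n + 1) n
    refine ⟨(-1) ^ n * z, ?_⟩
    rw [Polynomial.eval_prod]
    simp only [Polynomial.eval_sub, Polynomial.eval_X, Polynomial.eval_C]
    have : ∏ k ∈ range n, ((node i : ℚ) - ((l * n + k + 1 : ℕ) : ℚ)) =
        ∏ k ∈ range n, (-1 * ((i + l * n + 1 + k : ℕ) : ℚ)) := by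
      refine prod_congr rfl fun k _ => ?_
      simp only [node]
      push_cast
      ring
    rw [this, prod_mul_distrib, prod_const, card_range, ← Nat.cast_prod,
      ← Nat.ascFactorial_eq_prod_range, hz]
    push_cast
    ring
  have hright : ∀ l, ((∏ i ∈ range n,
      (Polynomial.X + Polynomial.C ((n + 1 + (l * n + i) : ℕ) : ℚ))).comp
      (Polynomial.X + Polynomial.C c) : ℚ[X]) * U ∈ D := by
    intro l
    refine block_mem_integralSeries hj (degree_prod_linear_le _ _ fun i =>
      (Polynomial.degree_X_add_C _).le) ?_
    intro i hi
    obtain ⟨z, hz⟩ := Nat.factorial_dvd_ascFactorial (n - i + l * n + 1) n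
    refine ⟨z, ?_⟩
    rw [Polynomial.eval_prod]
    simp only [Polynomial.eval_add, Polynomial.eval_X, Polynomial.eval_C]
    have : ∏ k ∈ range n, ((node i : ℚ) + ((n + 1 + (l * n + k) : ℕ) : ℚ)) =
        ∏ k ∈ range n, ((n - i + l * n + 1 + k : ℕ) : ℚ) := by
      refine prod_congr rfl fun k _ => ?_
      simp only [node]
      push_cast [Nat.cast_sub hi]
      ring
    rw [this, ← Nat.cast_prod, ← Nat.ascFactorial_eq_prod_range, hz]
    push_cast
    ring
  have hlin : (PowerSeries.C (2 : ℚ) * PowerSeries.X + PowerSeries.C ((n : ℚ) - 2 * j)) ∈ D := by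
    have h1 := C_mem_integralSeries (d n) 2
    have h2 := C_mem_integralSeries (d n) (n - 2 * j)
    push_cast at h1 h2
    exact add_mem (mul_mem h1 (X_mem_integralSeries _)) h2
  have h1 := pow_mem hfac (a - 2 * r)
  have h2 := prod_mem fun l (_ : l ∈ range r) => hleft l
  have h3 := prod_mem fun l (_ : l ∈ range r) => hright l
  have hmem := mul_mem (mul_mem (mul_mem h1 h2) h3) hlin
  convert hmem using 1
  rw [prod_mul_distrib, prod_mul_distrib, prod_const, card_range, poleSeries_eq,
    prod_range_mul', prod_range_mul']
  have hl : ∏ l ∈ range r, ((((∏ i ∈ range n,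
      (Polynomial.X - Polynomial.C ((l * n + i + 1 : ℕ) : ℚ))).comp
      (Polynomial.X + Polynomial.C c) : ℚ[X]) : ℚ⟦X⟧)) = ∏ l ∈ range r, ∏ i ∈ range n,
      (PowerSeries.X + PowerSeries.C (-((j + (l * n + i) + 1 : ℕ) : ℚ))) := by
    refine prod_congr rfl fun l _ => ?_
    rw [coe_prod_comp]
    refine prod_congr rfl fun i _ => ?_
    rw [sub_eq_add_neg, ← Polynomial.C_neg, coe_X_add_C_comp]
    congr 2
    simp only [c, node]
    push_cast
    ring
  have hr : ∏ l ∈ range r, ((((∏ i ∈ range n,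
      (Polynomial.X + Polynomial.C ((n + 1 + (l * n + i) : ℕ) : ℚ))).comp
      (Polynomial.X + Polynomial.C c) : ℚ[X]) : ℚ⟦X⟧)) = ∏ l ∈ range r, ∏ i ∈ range n,
      (PowerSeries.X + PowerSeries.C (((n + 1 + (l * n + i) : ℕ) : ℚ) - j)) := by
    refine prod_congr rfl fun l _ => ?_
    rw [coe_prod_comp]
    refine prod_congr rfl fun i _ => ?_
    rw [coe_X_add_C_comp]
    congr 2
    simp only [c, node]
    push_cast
    ring
  rw [hl, hr, Polynomial.C_comp, Polynomial.coe_C, mul_pow, ← map_pow]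
  obtain ⟨e, rfl⟩ : ∃ e, a = e + r + r := ⟨a - 2 * r, by omega⟩
  have he : e + r + r - 2 * r = e := by omega
  rw [he]
  change _ * U ^ (e + r + r) = _
  ring

/-! ### Size of the coefficients -/

/-- The quotient of factorials is the multinomial coefficient with `r + 1` parts `j` and `r` parts
`k`, one term in the expansion of the power of `1 + ⋯ + 1 = 2r + 1`. -/
theorem factorial_add_le {j k r : ℕ} :
    (j + r * (j + k)).factorial ≤
      (2 * r + 1) ^ (j + r * (j + k)) * (j.factorial ^ (r + 1) * k.factorial ^ r) := by
  -- The value `0` past `2r` is forced by `piAntidiag`, whose members are supported in the index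
  -- set.
  set f : ℕ → ℕ := fun i => if i < r + 1 then j else if i < 2 * r + 1 then k else 0 with hf
  have hsplit : range (2 * r + 1) = range (r + 1 + r) := by congr 1; omega
  have hsum : ∑ i ∈ range (2 * r + 1), f i = j + r * (j + k) := by
    rw [hsplit, sum_range_add]
    have h1 : ∑ x ∈ range (r + 1), f x = ∑ x ∈ range (r + 1), j :=
      sum_congr rfl fun i hi => if_pos (mem_range.1 hi)
    have h2 : ∑ x ∈ range r, f (r + 1 + x) = ∑ x ∈ range r, k :=
      sum_congr rfl fun i hi => by
        have := mem_range.1 hi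
        simp only [hf]
        rw [if_neg (by omega), if_pos (by omega)]
    rw [h1, h2]
    simp only [sum_const, card_range, smul_eq_mul]
    ring
  have hprod : ∏ i ∈ range (2 * r + 1), (f i).factorial = j.factorial ^ (r + 1) * k.factorial ^ r := by
    rw [hsplit, prod_range_add]
    have h1 : ∏ x ∈ range (r + 1), (f x).factorial = ∏ x ∈ range (r + 1), j.factorial :=
      prod_congr rfl fun i hi => congrArg _ (if_pos (mem_range.1 hi))
    have h2 : ∏ x ∈ range r, (f (r + 1 + x)).factorial = ∏ x ∈ range r, k.factorial :=
      prod_congr rfl fun i hi => by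
        have := mem_range.1 hi
        simp only [hf]
        rw [if_neg (by omega), if_pos (by omega)]
    rw [h1, h2]
    simp
  have h := Finset.sum_pow_eq_sum_piAntidiag (range (2 * r + 1)) (fun _ => (1 : ℕ))
    (j + r * (j + k))
  simp only [sum_const, card_range, smul_eq_mul, mul_one, one_pow, prod_const_one,
    Nat.cast_id] at h
  have hm : f ∈ piAntidiag (range (2 * r + 1)) (j + r * (j + k)) := by
    rw [mem_piAntidiag]
    refine ⟨hsum, fun i hi => ?_⟩
    by_contra hc
    rw [mem_range] at hc
    apply hi
    simp only [hf]
    rw [if_neg (by omega), if_neg (by omega)]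
  have hle : Nat.multinomial (range (2 * r + 1)) f ≤ (2 * r + 1) ^ (j + r * (j + k)) := by
    rw [h]
    exact single_le_sum (f := fun g => Nat.multinomial (range (2 * r + 1)) g)
      (fun _ _ => Nat.zero_le _) hm
  rw [← hsum, ← Nat.multinomial_spec, hprod, hsum, mul_comm]
  exact Nat.mul_le_mul_right _ hle

/-- Each `n!` costs `2 ^ n` through a binomial coefficient. The other two factorials cost powers of
`2r + 1` with exponents `j + rn` and `n - j + rn`, whose sum is `(2r + 1) n` for every `j`. -/
theorem factorial_quotient_le {a r n j : ℕ} (hra : 2 * r < a) (hj : j ≤ n) :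
    (n.factorial : ℝ) ^ (a - 2 * r) * (j + r * n).factorial * (n - j + r * n).factorial ≤
      (2 ^ (a - 2 * r) * (2 * (r : ℝ) + 1) ^ (2 * r + 1)) ^ n *
        ((j.factorial * (n - j).factorial : ℝ) ^ a * (j.factorial * (n - j).factorial)) := by
  obtain ⟨k, rfl⟩ := Nat.exists_eq_add_of_le hj
  rw [Nat.add_sub_cancel_left]
  obtain ⟨e, rfl⟩ : ∃ e, a = e + 2 * r := ⟨a - 2 * r, by omega⟩
  rw [Nat.add_sub_cancel]
  have h1 : ((j + k).factorial : ℝ) ≤ 2 ^ (j + k) * (j.factorial * k.factorial) := by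
    have h := Nat.add_choose_mul_factorial_mul_factorial j k
    have h' := Nat.choose_le_two_pow (j + k) k
    have h'' : (j + k).factorial ≤ 2 ^ (j + k) * (j.factorial * k.factorial) := by
      rw [← h, mul_assoc]
      exact Nat.mul_le_mul_right _ h'
    exact_mod_cast h''
  have h2 : ((j + r * (j + k)).factorial : ℝ) ≤ (2 * (r : ℝ) + 1) ^ (j + r * (j + k)) *
      (j.factorial ^ (r + 1) * k.factorial ^ r) := by
    exact_mod_cast factorial_add_le
  have h3 : ((k + r * (j + k)).factorial : ℝ) ≤ (2 * (r : ℝ) + 1) ^ (k + r * (j + k)) *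
      (k.factorial ^ (r + 1) * j.factorial ^ r) := by
    rw [add_comm j k]
    exact_mod_cast factorial_add_le
  calc _ ≤ (2 ^ (j + k) * (j.factorial * k.factorial : ℝ)) ^ e *
        ((2 * (r : ℝ) + 1) ^ (j + r * (j + k)) * (j.factorial ^ (r + 1) * k.factorial ^ r)) *
        ((2 * (r : ℝ) + 1) ^ (k + r * (j + k)) * (k.factorial ^ (r + 1) * j.factorial ^ r)) := by
        gcongr
    _ = _ := by
        generalize 2 * (r : ℝ) + 1 = b
        ring

theorem prod_inv_half_le (N : ℕ) :
    ∏ i ∈ range N, 1 / ((i + 1 : ℝ) - 1 / 2) ≤ (N + 1) / N.factorial := by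
  induction N with
  | zero => simp
  | succ N ih =>
    rw [prod_range_succ]
    have hN : (0 : ℝ) ≤ N := Nat.cast_nonneg N
    have hpos : (0 : ℝ) < N + 1 - 1 / 2 := by linarith
    calc _ ≤ ((N : ℝ) + 1) / N.factorial * (1 / ((N + 1 : ℝ) - 1 / 2)) := by gcongr
      _ ≤ _ := by
        rw [Nat.factorial_succ]
        push_cast
        have hf : (0 : ℝ) < N.factorial := by exact_mod_cast N.factorial_pos
        rw [div_mul_div_comm, mul_one, div_le_div_iff₀ (by positivity) (by positivity)]
        have : (N + 1 : ℝ) * (N + 1) ≤ (N + 1 + 1) * (N + 1 - 1 / 2) := by nlinarith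
        nlinarith [mul_le_mul_of_nonneg_right this hf.le]

theorem normLE_cofactor {n j : ℕ} (hj : j ≤ n) :
    NormLE (cofactor (range (n + 1)) (fun i => (node i : ℚ)) j)
      ((n + 1) ^ 2 / (j.factorial * (n - j).factorial)) := by
  rw [cofactor, prod_range_erase _ hj]
  have h1 : NormLE (∏ i ∈ range j, geom ((node j : ℚ) - node (j - 1 - i)))
      ((j + 1) / j.factorial) := by
    refine NormLE.mono (NormLE.prod fun i hi => ?_) (prod_inv_half_le j)
    have h : (node j : ℚ) - node (j - 1 - i) = -(i + 1) := by
      simp only [node, Int.cast_neg, Int.cast_natCast]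
      rw [cast_sub_one_sub (mem_range.1 hi)]
      ring
    rw [h]
    have hq : |(-((i : ℚ) + 1))| = i + 1 := by rw [abs_neg, abs_of_nonneg (by positivity)]
    have := normLE_geom (b := -((i : ℚ) + 1)) (by rw [hq]; linarith [Nat.cast_nonneg (α := ℚ) i])
    convert this using 3
    push_cast
    rw [abs_neg, abs_of_nonneg (by positivity)]
  have h2 : NormLE (∏ i ∈ range (n - j), geom ((node j : ℚ) - node (j + 1 + i)))
      (((n - j : ℕ) + 1) / (n - j).factorial) := by
    refine NormLE.mono (NormLE.prod fun i hi => ?_) (prod_inv_half_le (n - j))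
    have h : (node j : ℚ) - node (j + 1 + i) = i + 1 := by
      simp only [node]
      push_cast
      ring
    rw [h]
    have hq : |((i : ℚ) + 1)| = i + 1 := by rw [abs_of_nonneg (by positivity)]
    have := normLE_geom (b := ((i : ℚ) + 1)) (by rw [hq]; linarith [Nat.cast_nonneg (α := ℚ) i])
    convert this using 3
    push_cast
    rw [abs_of_nonneg (by positivity)]
  refine (h1.mul h2).mono ?_
  rw [div_mul_div_comm, sq]
  have hj' : (j : ℝ) ≤ n := by exact_mod_cast hj
  have hj'' : ((n - j : ℕ) : ℝ) ≤ n := by exact_mod_cast Nat.sub_le n j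
  gcongr

theorem prod_add_half_le (j M : ℕ) :
    ∏ i ∈ range M, (1 / 2 + ((j + i + 1 : ℕ) : ℝ)) ≤
      (j + M + 1) * ((j + M).factorial / j.factorial) := by
  induction M with
  | zero =>
    have : (j.factorial : ℝ) ≠ 0 := by exact_mod_cast j.factorial_ne_zero
    simp [this]
  | succ M ih =>
    rw [prod_range_succ, ← add_assoc j M 1, Nat.factorial_succ]
    calc _ ≤ ((j + M + 1 : ℝ) * ((j + M).factorial / j.factorial)) *
          (1 / 2 + ((j + M + 1 : ℕ) : ℝ)) := by gcongr
      _ ≤ ((j + M + 1 : ℝ) * ((j + M).factorial / j.factorial)) *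
          (1 + ((j + M + 1 : ℕ) : ℝ)) := by gcongr; norm_num
      _ = _ := by push_cast; ring

theorem normLE_X_add_C (b : ℚ) :
    NormLE (PowerSeries.X + PowerSeries.C b) (1 / 2 + |(b : ℝ)|) := normLE_X.add (normLE_C b)

theorem normLE_poleSeries {a r n j : ℕ} (hra : 2 * r < a) (hj : j ≤ n) :
    NormLE (poleSeries a r n j) ((r + 2) ^ 2 * (n + 1) ^ (2 * a + 3) *
      (2 ^ (a - 2 * r) * (2 * (r : ℝ) + 1) ^ (2 * r + 1)) ^ n) := by
  have hj' : (j : ℝ) ≤ n := by exact_mod_cast hj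
  have h1 := normLE_C ((n.factorial : ℚ) ^ (a - 2 * r))
  have h2 : NormLE (PowerSeries.C (2 : ℚ) * PowerSeries.X + PowerSeries.C ((n : ℚ) - 2 * j))
      (n + 1) := by
    refine (((normLE_C 2).mul normLE_X).add (normLE_C _)).mono ?_
    push_cast
    have : |(n : ℝ) - 2 * j| ≤ n := by rw [abs_le]; constructor <;> linarith [Nat.cast_nonneg (α := ℝ) j]
    rw [abs_two]
    linarith
  have h3 : NormLE (∏ i ∈ range (r * n),
      (PowerSeries.X + PowerSeries.C (-((j + i + 1 : ℕ) : ℚ))))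
      ((j + (r * n : ℕ) + 1) * ((j + r * n).factorial / j.factorial)) := by
    refine (NormLE.prod fun i _ => normLE_X_add_C _).mono (le_trans (le_of_eq ?_)
      (prod_add_half_le j (r * n)))
    refine prod_congr rfl fun i _ => ?_
    rw [Rat.cast_neg, abs_neg, Rat.cast_natCast, abs_of_nonneg (by positivity)]
  have h4 : NormLE (∏ i ∈ range (r * n),
      (PowerSeries.X + PowerSeries.C (((n + 1 + i : ℕ) : ℚ) - j)))
      (((n - j : ℕ) + (r * n : ℕ) + 1) * ((n - j + r * n).factorial / (n - j).factorial)) := by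
    refine (NormLE.prod fun i _ => normLE_X_add_C _).mono (le_trans (le_of_eq ?_)
      (prod_add_half_le (n - j) (r * n)))
    refine prod_congr rfl fun i _ => ?_
    have : ((n + 1 + i : ℕ) : ℚ) - j = ((n - j + i + 1 : ℕ) : ℚ) := by
      push_cast [Nat.cast_sub hj]
      ring
    rw [this, Rat.cast_natCast, abs_of_nonneg (by positivity)]
  have h5 := (normLE_cofactor hj).pow a
  rw [poleSeries_eq]
  refine ((((h1.mul h2).mul h3).mul h4).mul h5).mono ?_
  have hq := factorial_quotient_le hra hj
  set E : ℝ := (2 ^ (a - 2 * r) * (2 * (r : ℝ) + 1) ^ (2 * r + 1)) ^ n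
  have hfj : (0 : ℝ) < j.factorial := by exact_mod_cast j.factorial_pos
  have hfk : (0 : ℝ) < (n - j).factorial := by exact_mod_cast (n - j).factorial_pos
  set F : ℝ := (j.factorial : ℝ)
  set G : ℝ := ((n - j).factorial : ℝ)
  have hkn : ((n - j : ℕ) : ℝ) ≤ n := by exact_mod_cast Nat.sub_le n j
  have hn0 : (0 : ℝ) ≤ n := Nat.cast_nonneg n
  have hr0 : (0 : ℝ) ≤ r := Nat.cast_nonneg r
  have hA : (j : ℝ) + (r * n : ℕ) + 1 ≤ (r + 2) * (n + 1) := by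
    push_cast; nlinarith
  have hB : ((n - j : ℕ) : ℝ) + (r * n : ℕ) + 1 ≤ (r + 2) * (n + 1) := by
    push_cast; nlinarith
  rw [Rat.cast_pow, Rat.cast_natCast, abs_of_nonneg (by positivity)]
  -- The exponent `2a + 3` of `n + 1` collects `1` from the linear factor, `1` from each of the two
  -- long products and `2a` from the cofactors.
  calc _ = ((n : ℝ) + 1) * (j + (r * n : ℕ) + 1) * ((n - j : ℕ) + (r * n : ℕ) + 1) *
        ((n + 1) ^ 2) ^ a * (((n.factorial : ℝ) ^ (a - 2 * r) * (j + r * n).factorial *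
          (n - j + r * n).factorial) / ((F * G) ^ a * (F * G))) := by
        rw [div_pow]
        field_simp
    _ ≤ ((n : ℝ) + 1) * ((r + 2) * (n + 1)) * ((r + 2) * (n + 1)) *
        ((n + 1) ^ 2) ^ a * E := by
        gcongr
        rw [div_le_iff₀ (by positivity)]
        exact hq
    _ = _ := by
        rw [← pow_mul]
        generalize (n : ℝ) + 1 = b
        ring

/-! ### Symmetry and vanishing of coefficient sums -/

/-- The coefficient of `1 / (x + j) ^ i` in the partial fraction decomposition of `R`. -/
noncomputable def coef (a r n i j : ℕ) : ℚ := PowerSeries.coeff (a - i) (poleSeries a r n j)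

theorem rescale_neg_one_C (b : ℚ) :
    PowerSeries.rescale (-1) (PowerSeries.C b) = PowerSeries.C b := by
  ext m
  rw [PowerSeries.coeff_rescale, PowerSeries.coeff_C]
  split_ifs with h
  · simp [h]
  · simp

theorem rescale_neg_one_X_add_C (b : ℚ) :
    PowerSeries.rescale (-1) ((PowerSeries.X : ℚ⟦X⟧) + PowerSeries.C b) =
      -1 * (PowerSeries.X + PowerSeries.C (-b)) := by
  rw [map_add, rescale_neg_one_C, PowerSeries.rescale_neg_one_X, map_neg]
  ring

theorem rescale_neg_one_geom (b : ℚ) :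
    PowerSeries.rescale (-1) (geom b) = -geom (-b) := by
  ext m
  rw [PowerSeries.coeff_rescale, map_neg, geom, geom, PowerSeries.coeff_mk, PowerSeries.coeff_mk,
    neg_pow b, pow_succ (-1 : ℚ) m]
  rcases neg_one_pow_eq_or ℚ m with h | h <;> rw [h] <;> ring

theorem rescale_neg_one_cofactor_pow {a n j : ℕ} (ha : Even a) (hj : j ≤ n) :
    PowerSeries.rescale (-1) (cofactor (range (n + 1)) (fun i => (node i : ℚ)) j ^ a) =
      cofactor (range (n + 1)) (fun i => (node i : ℚ)) (n - j) ^ a := by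
  rw [map_pow, cofactor, map_prod, cofactor, ← prod_pow, ← prod_pow]
  refine prod_nbij' (fun h => n - h) (fun h => n - h) ?_ ?_ ?_ ?_ ?_
  · intro h hh
    simp only [mem_erase, mem_range] at hh ⊢
    omega
  · intro h hh
    simp only [mem_erase, mem_range] at hh ⊢
    omega
  · intro h hh
    simp only [mem_erase, mem_range] at hh
    omega
  · intro h hh
    simp only [mem_erase, mem_range] at hh
    omega
  · intro h hh
    simp only [mem_erase, mem_range] at hh
    rw [rescale_neg_one_geom, ha.neg_pow]
    congr 2
    simp only [node]
    push_cast [Nat.cast_sub hj, Nat.cast_sub (Nat.lt_succ_iff.1 hh.2)]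
    ring

/-- This is `R(-n - x) = -R(x)` read at the pole `-j`: the two long products are exchanged with
signs `(-1) ^ (rn)` that cancel, the denominator is unchanged since `a` is even, and the linear
factor changes sign. -/
theorem poleSeries_reflect {a r n j : ℕ} (ha : Even a) (hj : j ≤ n) :
    poleSeries a r n (n - j) = -PowerSeries.rescale (-1) (poleSeries a r n j) := by
  rw [poleSeries_eq, poleSeries_eq a r n j]
  simp only [map_mul, rescale_neg_one_cofactor_pow ha hj, map_prod, rescale_neg_one_X_add_C,
    prod_mul_distrib, prod_const, card_range, rescale_neg_one_C]
  have h1 : PowerSeries.rescale (-1) (PowerSeries.C (2 : ℚ) * PowerSeries.X +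
      PowerSeries.C ((n : ℚ) - 2 * j)) = -(PowerSeries.C (2 : ℚ) * PowerSeries.X +
      PowerSeries.C ((n : ℚ) - 2 * (n - j : ℕ))) := by
    have h2 : (n : ℚ) - 2 * (n - j : ℕ) = -((n : ℚ) - 2 * j) := by
      rw [Nat.cast_sub hj]; ring
    rw [h2, map_add, map_mul, rescale_neg_one_C, rescale_neg_one_C,
      PowerSeries.rescale_neg_one_X, map_neg]
    ring
  have h2 : ∏ i ∈ range (r * n), ((PowerSeries.X : ℚ⟦X⟧) +
      PowerSeries.C (-(-((j + i + 1 : ℕ) : ℚ)))) = ∏ i ∈ range (r * n),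
      (PowerSeries.X + PowerSeries.C (((n + 1 + i : ℕ) : ℚ) - (n - j : ℕ))) := by
    refine prod_congr rfl fun i _ => ?_
    congr 2
    push_cast [Nat.cast_sub hj]
    ring
  have h3 : ∏ i ∈ range (r * n), ((PowerSeries.X : ℚ⟦X⟧) +
      PowerSeries.C (-(((n + 1 + i : ℕ) : ℚ) - j))) = ∏ i ∈ range (r * n),
      (PowerSeries.X + PowerSeries.C (-((n - j + i + 1 : ℕ) : ℚ))) := by
    refine prod_congr rfl fun i _ => ?_
    congr 2
    push_cast [Nat.cast_sub hj]
    ring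
  have h4 : ((-1 : ℚ⟦X⟧) ^ (r * n)) * (-1) ^ (r * n) = 1 := by
    rw [← mul_pow]; norm_num
  rw [h1, h2, h3]
  generalize cofactor (range (n + 1)) (fun i => (node i : ℚ)) (n - j) ^ a = U
  generalize ∏ i ∈ range (r * n), ((PowerSeries.X : ℚ⟦X⟧) +
    PowerSeries.C (((n + 1 + i : ℕ) : ℚ) - (n - j : ℕ))) = A
  generalize ∏ i ∈ range (r * n), ((PowerSeries.X : ℚ⟦X⟧) +
    PowerSeries.C (-((n - j + i + 1 : ℕ) : ℚ))) = B
  generalize PowerSeries.C (2 : ℚ) * PowerSeries.X +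
    PowerSeries.C ((n : ℚ) - 2 * (n - j : ℕ)) = L
  linear_combination -(PowerSeries.C ((n.factorial : ℚ) ^ (a - 2 * r)) * L * A * B * U) * h4

theorem coef_reflect {a r n i j : ℕ} (ha : Even a) (hi : i ≤ a) (hj : j ≤ n) :
    coef a r n i (n - j) = (-1) ^ (i + 1) * coef a r n i j := by
  have h : ((-1 : ℚ)) ^ (a - i) = (-1) ^ i := by
    have h1 : ((-1 : ℚ)) ^ (a - i) * (-1) ^ i = 1 := by
      rw [← pow_add, Nat.sub_add_cancel hi, ha.neg_one_pow]
    have h2 : ((-1 : ℚ)) ^ i * (-1) ^ i = 1 := by rw [← mul_pow]; norm_num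
    calc ((-1 : ℚ)) ^ (a - i) = (-1) ^ (a - i) * ((-1 : ℚ) ^ i * (-1) ^ i) := by rw [h2, mul_one]
      _ = _ := by rw [← mul_assoc, h1, one_mul]
  rw [coef, coef, poleSeries_reflect ha hj, map_neg, PowerSeries.coeff_rescale, h]
  ring

theorem sum_coef_eq_zero_of_even {a r n i : ℕ} (ha : Even a) (hi : i ≤ a) (hie : Even i) :
    ∑ j ∈ range (n + 1), coef a r n i j = 0 := by
  have h1 := sum_flip (n := n) (fun j => coef a r n i j)
  have h2 : ∑ j ∈ range (n + 1), coef a r n i (n - j) =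
      ∑ j ∈ range (n + 1), -coef a r n i j := by
    refine sum_congr rfl fun j hj => ?_
    rw [coef_reflect ha hi (Nat.lt_succ_iff.1 (mem_range.1 hj)), pow_succ, hie.neg_one_pow]
    ring
  rw [h2, sum_neg_distrib] at h1
  linarith

theorem natDegree_numer_le (a r n : ℕ) : (numer a r n).natDegree ≤ 1 + 2 * (r * n) := by
  have hprod : ∀ p : ℕ → ℚ[X], (∀ i, (p i).natDegree ≤ 1) →
      (∏ i ∈ range (r * n), p i).natDegree ≤ r * n := by
    intro p hp
    refine (Polynomial.natDegree_prod_le _ _).trans ((sum_le_sum fun i _ => hp i).trans ?_)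
    simp
  rw [numer]
  refine Polynomial.natDegree_mul_le.trans ?_
  have h1 := hprod (fun i => Polynomial.X + Polynomial.C ((n + 1 + i : ℕ) : ℚ))
    (fun i => (Polynomial.natDegree_X_add_C _).le)
  have h2 := hprod (fun i => Polynomial.X - Polynomial.C ((i + 1 : ℕ) : ℚ))
    (fun i => (Polynomial.natDegree_X_sub_C _).le)
  have h3 : (Polynomial.C ((n.factorial : ℚ) ^ (a - 2 * r)) *
    (Polynomial.C 2 * Polynomial.X + Polynomial.C (n : ℚ))).natDegree ≤ 1 := by
    refine (Polynomial.natDegree_C_mul_le _ _).trans ?_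
    exact Polynomial.natDegree_linear_le
  have h4 := (Polynomial.natDegree_mul_le (p := Polynomial.C ((n.factorial : ℚ) ^ (a - 2 * r)) *
    (Polynomial.C 2 * Polynomial.X + Polynomial.C (n : ℚ)))
    (q := ∏ i ∈ range (r * n), (Polynomial.X - Polynomial.C ((i + 1 : ℕ) : ℚ))))
  omega

theorem natDegree_numer_lt {a r n : ℕ} (hr : 1 ≤ r) (hra : 2 * r < a) :
    (numer a r n).natDegree < a * n + (a - 1) := by
  have h := natDegree_numer_le a r n
  have h2 : (2 * r + 1) * n ≤ a * n := Nat.mul_le_mul_right _ hra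
  have h3 : (2 * r + 1) * n = 2 * (r * n) + n := by ring
  omega

theorem numer_eq_sum {a r n : ℕ} (hr : 1 ≤ r) (hra : 2 * r < a) :
    numer a r n = ∑ j ∈ range (n + 1), (PowerSeries.trunc a (poleSeries a r n j)).comp
        (Polynomial.X - Polynomial.C (node j : ℚ)) *
      ∏ h ∈ (range (n + 1)).erase j, (Polynomial.X - Polynomial.C (node h : ℚ)) ^ a := by
  refine eq_sum_localSeries (v := fun i => (node i : ℚ)) ?_ a _ ?_
  · exact fun i _ j _ e => node_injective (by simpa using e)
  · refine lt_of_le_of_lt Polynomial.degree_le_natDegree ?_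
    have h := natDegree_numer_lt (n := n) hr hra
    rw [card_range, mul_add]
    exact_mod_cast (by omega : (numer a r n).natDegree < a * n + a * 1)

/-- The sum of the residues of a rational function that is `O(x⁻²)` at infinity vanishes.
Algebraically, it is the coefficient of `x ^ (a - 1 + a * n)` in the numerator, which lies beyond
its degree. -/
theorem sum_coef_one {a r n : ℕ} (hr : 1 ≤ r) (hra : 2 * r < a) :
    ∑ j ∈ range (n + 1), coef a r n 1 j = 0 := by
  have h := congrArg (fun p => Polynomial.coeff p (a - 1 + a * n)) (numer_eq_sum (n := n) hr hra)
  rw [Polynomial.coeff_eq_zero_of_natDegree_lt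
    (by have := natDegree_numer_lt (n := n) hr hra; omega), Polynomial.finsetSum_coeff] at h
  rw [h]
  refine sum_congr rfl fun j hj => ?_
  set Q := ∏ h ∈ (range (n + 1)).erase j, (Polynomial.X - Polynomial.C (node h : ℚ)) ^ a
  have hQ : Q.Monic := Polynomial.monic_prod_of_monic _ _ fun h _ =>
    (Polynomial.monic_X_sub_C _).pow a
  have hQd : Q.natDegree = a * n := by
    rw [Polynomial.natDegree_prod_of_monic _ _ fun h _ => (Polynomial.monic_X_sub_C _).pow a]
    simp only [Polynomial.natDegree_pow, Polynomial.natDegree_X_sub_C, sum_const,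
      card_erase_of_mem hj, card_range, smul_eq_mul, Nat.add_sub_cancel, mul_one]
    ring
  set T := PowerSeries.trunc a (poleSeries a r n j)
  have hT : T.natDegree ≤ a - 1 := by
    have := PowerSeries.natDegree_trunc_lt (poleSeries a r n j) (a - 1)
    rw [Nat.sub_add_cancel (by omega)] at this
    exact Nat.le_sub_one_of_lt this
  have hTc : (T.comp (Polynomial.X - Polynomial.C (node j : ℚ))).coeff (a - 1) =
      T.coeff (a - 1) := by
    have hd : (T.comp (Polynomial.X - Polynomial.C (node j : ℚ))).natDegree = T.natDegree := by
      rw [Polynomial.natDegree_comp, Polynomial.natDegree_X_sub_C, mul_one]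
    rcases hT.lt_or_eq with h | h
    · rw [Polynomial.coeff_eq_zero_of_natDegree_lt h,
        Polynomial.coeff_eq_zero_of_natDegree_lt (hd ▸ h)]
    · have := Polynomial.coeff_comp_degree_mul_degree (p := T)
        (q := Polynomial.X - Polynomial.C (node j : ℚ))
        (by rw [Polynomial.natDegree_X_sub_C]; exact one_ne_zero)
      rw [Polynomial.natDegree_X_sub_C, mul_one, Polynomial.leadingCoeff_X_sub_C, one_pow,
        mul_one, Polynomial.leadingCoeff, h] at this
      exact this
  rw [Polynomial.coeff_mul_add_eq_of_natDegree_le ?_ hQd.le, hTc, ← hQd, hQ.coeff_natDegree,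
    mul_one, PowerSeries.coeff_trunc, if_pos (by omega), coef]
  rw [Polynomial.natDegree_comp, Polynomial.natDegree_X_sub_C, mul_one]
  exact hT

/-! ### Partial fraction decomposition of `R` -/

theorem ascPochhammer_eval_eq_prod {K : Type*} [CommRing K] (n : ℕ) (x : K) :
    (ascPochhammer K n).eval x = ∏ i ∈ range n, (x + i) := by
  induction n with
  | zero => simp
  | succ n ih => rw [ascPochhammer_succ_eval, ih, prod_range_succ]

theorem aeval_numer (a r n : ℕ) (x : ℂ) :
    Polynomial.aeval x (numer a r n) =
      2 * (n.factorial : ℂ) ^ (a - 2 * r) * (x + (n : ℂ) / 2) *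
      ((ascPochhammer ℂ (r * n)).eval (x - (r : ℂ) * n) *
        (ascPochhammer ℂ (r * n)).eval (x + (n : ℂ) + 1)) := by
  rw [numer, ascPochhammer_eval_eq_prod, ascPochhammer_eval_eq_prod]
  simp only [map_mul, map_prod, map_add, map_sub, Polynomial.aeval_X, Polynomial.aeval_C]
  have h1 : ∏ i ∈ range (r * n), (x - (r : ℂ) * n + i) =
      ∏ i ∈ range (r * n), (x - algebraMap ℚ ℂ ((i + 1 : ℕ) : ℚ)) := by
    rw [← prod_range_reflect]
    refine prod_congr rfl fun i hi => ?_
    have h := mem_range.1 hi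
    have : ((r * n - 1 - i : ℕ) : ℂ) + (i + 1) = r * n := by
      exact_mod_cast (by omega : r * n - 1 - i + (i + 1) = r * n)
    rw [map_natCast]
    push_cast
    linear_combination this
  have h2 : ∏ i ∈ range (r * n), (x + (n : ℂ) + 1 + i) =
      ∏ i ∈ range (r * n), (x + algebraMap ℚ ℂ ((n + 1 + i : ℕ) : ℚ)) := by
    refine prod_congr rfl fun i _ => ?_
    rw [map_natCast]
    push_cast
    ring
  rw [h1, h2]
  simp only [map_pow, map_natCast, map_ofNat]
  ring

theorem R_eq_sum {a r n : ℕ} (hr : 1 ≤ r) (hra : 2 * r < a) {x : ℂ}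
    (hx : ∀ j ≤ n, x + j ≠ 0) :
    R a r n x = ∑ i ∈ Icc 1 a, ∑ j ∈ range (n + 1), (coef a r n i j : ℂ) / (x + j) ^ i := by
  rw [R, ← aeval_numer, numer_eq_sum hr hra, ascPochhammer_eval_eq_prod, map_sum, sum_div, sum_comm]
  refine sum_congr rfl fun j hj => ?_
  have hj' : j ≤ n := Nat.lt_succ_iff.1 (mem_range.1 hj)
  rw [← mul_prod_erase _ _ hj, mul_pow, map_mul, map_prod]
  have hQ : ∏ h ∈ (range (n + 1)).erase j, Polynomial.aeval x
      ((Polynomial.X - Polynomial.C (node h : ℚ)) ^ a) =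
      (∏ h ∈ (range (n + 1)).erase j, (x + h)) ^ a := by
    rw [← prod_pow]
    refine prod_congr rfl fun h _ => ?_
    simp [node]
  have hne : (∏ h ∈ (range (n + 1)).erase j, (x + h)) ^ a ≠ 0 := by
    refine pow_ne_zero _ (prod_ne_zero_iff.2 fun h hh => hx h ?_)
    exact Nat.lt_succ_iff.1 (mem_range.1 (mem_erase.1 hh).2)
  rw [hQ, mul_div_mul_right _ _ hne, Polynomial.aeval_comp, Polynomial.aeval_def,
    PowerSeries.eval₂_trunc_eq_sum_range, sum_div]
  have hxj := hx j hj'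
  -- The term of degree `m` in the expansion of `t ^ a * R` is the polar term of order `a - m`.
  refine sum_nbij' (fun m => a - m) (fun i => a - i) ?_ ?_ ?_ ?_ ?_
  · intro m hm
    simp only [mem_range, mem_Icc] at hm ⊢
    omega
  · intro m hm
    simp only [mem_range, mem_Icc] at hm ⊢
    omega
  · intro m hm
    simp only [mem_range] at hm
    omega
  · intro m hm
    simp only [mem_Icc] at hm
    omega
  · intro m hm
    have hm' := mem_range.1 hm
    rw [coef, Nat.sub_sub_self hm'.le]
    have : Polynomial.aeval x (Polynomial.X - Polynomial.C (node j : ℚ)) = x + j := by simp [node]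
    rw [this, div_eq_div_iff (pow_ne_zero _ hxj) (pow_ne_zero _ hxj), mul_assoc, ← pow_add,
      Nat.add_sub_cancel' hm'.le]
    rfl

/-! ### Arithmetic and growth of the linear form's coefficients -/

/-- The coefficients of the linear form `S n 1` in `1` and the zeta values. -/
noncomputable def kappa (a r n j : ℕ) : ℚ :=
  if j = 0 then
    -∑ i ∈ Icc 1 a, ∑ h ∈ range (n + 1), coef a r n i h * ∑ s ∈ range h, 1 / ((s + 1 : ℕ) : ℚ) ^ i
  else ∑ h ∈ range (n + 1), coef a r n j h

theorem coef_integral {a r n i j : ℕ} (hra : 2 * r < a) (hj : j ≤ n) :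
    ∃ z : ℤ, (d n : ℚ) ^ (a - i) * coef a r n i j = z :=
  mem_integralSeries.1 (poleSeries_mem_integralSeries hra hj) (a - i)

theorem exists_int_sum_eq {ι : Type*} (s : Finset ι) (f : ι → ℚ)
    (h : ∀ i ∈ s, ∃ z : ℤ, f i = z) : ∃ z : ℤ, ∑ i ∈ s, f i = z := by
  choose! z hz using h
  exact ⟨∑ i ∈ s, z i, by rw [Int.cast_sum]; exact sum_congr rfl hz⟩

/-- Of the `a` factors `d n`, `a - i` clear `coef a r n i h` and the other `i` clear the `i`-th
powers in the harmonic sum, whose bases are at most `h ≤ n`. -/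
theorem d_pow_mul_kappa_integral {a r n j : ℕ} (hra : 2 * r < a) (hja : j ≤ a) :
    ∃ m : ℤ, (d n : ℚ) ^ a * kappa a r n j = m := by
  rw [kappa]
  split_ifs with hj
  · have h : ∃ m : ℤ, ∑ i ∈ Icc 1 a, ∑ h ∈ range (n + 1), (d n : ℚ) ^ a *
        (coef a r n i h * ∑ s ∈ range h, 1 / ((s + 1 : ℕ) : ℚ) ^ i) = m := by
      refine exists_int_sum_eq _ _ fun i hi => exists_int_sum_eq _ _ fun h hh => ?_
      have hh' : h ≤ n := Nat.lt_succ_iff.1 (mem_range.1 hh)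
      obtain ⟨z, hz⟩ := coef_integral (r := r) (i := i) hra hh'
      obtain ⟨w, hw⟩ : ∃ w : ℤ, ∑ s ∈ range h, (d n : ℚ) ^ i * (1 / ((s + 1 : ℕ) : ℚ) ^ i) = w := by
        refine exists_int_sum_eq _ _ fun s hs => ?_
        have hs' := mem_range.1 hs
        obtain ⟨e, he⟩ : s + 1 ∣ d n :=
          Finset.dvd_lcm (f := id) (mem_Icc.2 ⟨by omega, by omega⟩)
        refine ⟨(e : ℤ) ^ i, ?_⟩
        have hs0 : ((s + 1 : ℕ) : ℚ) ≠ 0 := by exact_mod_cast s.succ_ne_zero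
        rw [he, Nat.cast_mul, mul_pow]
        field_simp
        push_cast
        ring
      refine ⟨z * w, ?_⟩
      rw [← mul_sum] at hw
      have hpow : (d n : ℚ) ^ a = (d n : ℚ) ^ (a - i) * (d n : ℚ) ^ i := by
        rw [← pow_add, Nat.sub_add_cancel (mem_Icc.1 hi).2]
      rw [Int.cast_mul, ← hz, ← hw, hpow]
      ring
    obtain ⟨m, hm⟩ := h
    refine ⟨-m, ?_⟩
    rw [Int.cast_neg, ← hm, mul_neg, mul_sum]
    simp only [mul_sum]
  · rw [mul_sum]
    refine exists_int_sum_eq _ _ fun h hh => ?_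
    obtain ⟨z, hz⟩ := coef_integral (r := r) (i := j) hra (Nat.lt_succ_iff.1 (mem_range.1 hh))
    refine ⟨d n ^ j * z, ?_⟩
    push_cast
    rw [← hz, ← mul_assoc, ← pow_add, Nat.add_sub_cancel' hja]

theorem abs_coef_le {a r n i j : ℕ} (hra : 2 * r < a) (hj : j ≤ n) :
    |(coef a r n i j : ℝ)| ≤ 2 ^ a * ((r + 2) ^ 2 * (n + 1) ^ (2 * a + 3) *
      (2 ^ (a - 2 * r) * (2 * (r : ℝ) + 1) ^ (2 * r + 1)) ^ n) := by
  refine ((normLE_poleSeries hra hj).abs_coeff_le (a - i)).trans ?_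
  gcongr
  · norm_num
  · omega

theorem abs_kappa_le {a r n j : ℕ} (hra : 2 * r < a) :
    |(kappa a r n j : ℝ)| ≤ a * 2 ^ a * (r + 2) ^ 2 * ((n : ℝ) + 1) ^ (2 * a + 5) *
      (2 ^ (a - 2 * r) * (2 * (r : ℝ) + 1) ^ (2 * r + 1)) ^ n := by
  set E : ℝ := (2 ^ (a - 2 * r) * (2 * (r : ℝ) + 1) ^ (2 * r + 1)) ^ n
  set M : ℝ := 2 ^ a * ((r + 2) ^ 2 * (n + 1) ^ (2 * a + 3) * E) with hM
  have hE : 0 ≤ E := by positivity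
  have hM0 : 0 ≤ M := by positivity
  have hc : ∀ i, ∀ h ∈ range (n + 1), |(coef a r n i h : ℝ)| ≤ M := fun i h hh =>
    abs_coef_le hra (Nat.lt_succ_iff.1 (mem_range.1 hh))
  have ha1 : (1 : ℝ) ≤ a := by exact_mod_cast (by omega : 1 ≤ a)
  have hfin : (a : ℝ) * ((n + 1) * (M * (n + 1))) = a * 2 ^ a * (r + 2) ^ 2 *
      ((n : ℝ) + 1) ^ (2 * a + 5) * E := by
    rw [hM]; ring
  rw [← hfin, kappa]
  split_ifs with hj
  · push_cast
    rw [abs_neg]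
    have hH : ∀ i, ∀ h ∈ range (n + 1), |(∑ s ∈ range h, 1 / ((s : ℝ) + 1) ^ i : ℝ)| ≤ n + 1 := by
      intro i h hh
      have hh' : (h : ℝ) ≤ n + 1 := by exact_mod_cast (mem_range.1 hh).le
      rw [abs_of_nonneg (sum_nonneg fun s _ => by positivity)]
      refine le_trans (sum_le_sum (g := fun _ => (1 : ℝ)) fun s _ => ?_) (by simpa using hh')
      rw [div_le_one (by positivity)]
      exact one_le_pow₀ (by linarith [Nat.cast_nonneg (α := ℝ) s])
    calc _ ≤ ∑ i ∈ Icc 1 a, ∑ h ∈ range (n + 1), M * ((n : ℝ) + 1) := by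
          refine (abs_sum_le_sum_abs _ _).trans (sum_le_sum fun i _ => ?_)
          refine (abs_sum_le_sum_abs _ _).trans (sum_le_sum fun h hh => ?_)
          rw [abs_mul]
          exact mul_le_mul (hc i h hh) (hH i h hh) (abs_nonneg _) hM0
      _ = _ := by simp
  · push_cast
    calc _ ≤ ∑ h ∈ range (n + 1), M :=
          (abs_sum_le_sum_abs _ _).trans (sum_le_sum fun h hh => hc j h hh)
      _ = 1 * ((n + 1) * (M * 1)) := by simp
      _ ≤ _ := by
        gcongr
        linarith [Nat.cast_nonneg (α := ℝ) n]

theorem tendsto_root_poly {C : ℝ} (hC : 0 < C) (D : ℕ) :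
    Tendsto (fun n : ℕ => (C * ((n : ℝ) + 1) ^ D) ^ (1 / (n : ℝ))) atTop (𝓝 1) := by
  have h1 : Tendsto (fun n : ℕ => ((n : ℝ) + 1) ^ (1 / (n : ℝ))) atTop (𝓝 1) := by
    -- At `x = n + 1` the exponent `1 / (1 * x + -1)` is `1 / n`.
    have := (tendsto_rpow_div_mul_add 1 1 (-1) (by norm_num)).comp
      (tendsto_natCast_atTop_atTop (R := ℝ) |>.comp (tendsto_add_atTop_nat 1))
    refine this.congr fun n => ?_
    simp
  have h2 : Tendsto (fun n : ℕ => C ^ (1 / (n : ℝ))) atTop (𝓝 1) := by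
    have := (tendsto_const_nhds (x := C)).rpow
      (tendsto_one_div_atTop_nhds_zero_nat (𝕜 := ℝ)) (Or.inl hC.ne')
    simpa using this
  have h3 := h2.mul (h1.pow D)
  rw [one_pow, one_mul] at h3
  refine h3.congr fun n => ?_
  rw [Real.mul_rpow hC.le (by positivity), ← Real.rpow_natCast, ← Real.rpow_natCast,
    ← Real.rpow_mul (by positivity), ← Real.rpow_mul (by positivity), mul_comm (D : ℝ)]

theorem root_mul_pow {x y : ℝ} (hx : 0 ≤ x) (hy : 0 ≤ y) {n : ℕ} (hn : n ≠ 0) :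
    (x * y ^ n) ^ (1 / (n : ℝ)) = x ^ (1 / (n : ℝ)) * y := by
  rw [Real.mul_rpow hx (by positivity), one_div, Real.pow_rpow_inv_natCast hy hn]

theorem limsup_kappa_le {a r : ℕ} (hra : 2 * r < a) (j : ℕ) :
    Filter.limsup (fun n : ℕ => ((|(kappa a r n j : ℝ)| ^ (1 / (n : ℝ)) : ℝ) : EReal)) atTop ≤
      ((2 ^ (a - 2 * r) * (2 * (r : ℝ) + 1) ^ (2 * r + 1) : ℝ) : EReal) := by
  set B : ℝ := 2 ^ (a - 2 * r) * (2 * (r : ℝ) + 1) ^ (2 * r + 1)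
  have ha : (0 : ℝ) < a := by exact_mod_cast (by omega : 0 < a)
  have hB : 0 ≤ B := by positivity
  have hC : (0 : ℝ) < a * 2 ^ a * (r + 2) ^ 2 := by positivity
  set C : ℝ := a * 2 ^ a * (r + 2) ^ 2
  have hlim : Tendsto (fun n : ℕ => ((((C * ((n : ℝ) + 1) ^ (2 * a + 5)) ^ (1 / (n : ℝ)) * B : ℝ)) :
      EReal)) atTop (𝓝 ((B : ℝ) : EReal)) := by
    have := (tendsto_root_poly hC (2 * a + 5)).mul_const B
    rw [one_mul] at this
    exact (continuous_coe_real_ereal.tendsto _).comp this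
  rw [← hlim.limsup_eq]
  refine limsup_le_limsup ?_
  filter_upwards [eventually_ne_atTop 0] with n hn
  refine EReal.coe_le_coe_iff.2 ?_
  rw [← root_mul_pow (by positivity) hB hn]
  exact Real.rpow_le_rpow (abs_nonneg _) (abs_kappa_le hra) (by positivity)

/-! ### The linear form in odd zeta values -/

theorem sum_range_shift (f : ℕ → ℂ) (N h : ℕ) :
    ∑ k ∈ range N, f (h + k) =
      ∑ k ∈ range N, f k + ∑ s ∈ range h, f (N + s) - ∑ s ∈ range h, f s := by
  have h1 := sum_range_add f N h
  have h2 := sum_range_add f h N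
  rw [add_comm h N, h1] at h2
  linear_combination -h2

theorem tendsto_inv_pow_zero {i : ℕ} (hi : 1 ≤ i) (s : ℕ) :
    Tendsto (fun N : ℕ => 1 / (((N + s : ℕ) : ℂ) + 1) ^ i) atTop (𝓝 0) := by
  have h1 : Tendsto (fun N : ℕ => 1 / (((N + s : ℕ) : ℂ) + 1)) atTop (𝓝 0) :=
    tendsto_one_div_add_atTop_nhds_zero_nat (𝕜 := ℂ) |>.comp (tendsto_add_atTop_nat s)
  have h2 := h1.pow i
  rw [zero_pow (by omega)] at h2
  refine h2.congr fun N => ?_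
  rw [div_pow, one_pow]

theorem tendsto_partial_zeta {i : ℕ} (hi : 1 < i) :
    Tendsto (fun N : ℕ => ∑ k ∈ range N, 1 / ((k : ℂ) + 1) ^ i) atTop (𝓝 (riemannZeta i)) := by
  have hs : Summable fun n : ℕ => 1 / (n : ℂ) ^ i := by
    have : Summable fun n : ℕ => ((1 / (n : ℝ) ^ i : ℝ) : ℂ) :=
      Complex.ofRealCLM.summable (Real.summable_one_div_nat_pow.2 hi)
    simpa using this
  have h1 := (hs.hasSum.tendsto_sum_nat).comp (tendsto_add_atTop_nat 1)
  rw [← zeta_nat_eq_tsum_of_gt_one hi] at h1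
  refine h1.congr fun N => ?_
  simp only [Function.comp]
  rw [sum_range_succ']
  simp [show i ≠ 0 by omega]

/-- The rearrangement is made on partial sums, because the pieces with `i = 1` diverge separately.
Their total coefficient vanishes before the limit is taken, and the boundary terms `T` left by
shifting each sum tend to zero. -/
theorem S_eq_of_summable {a r n : ℕ} (ha : Even a) (hr : 1 ≤ r) (hra : 2 * r < a)
    (hs : Summable (term a r n 1)) :
    S a r n 1 = (kappa a r n 0 : ℂ) +
      ∑ j ∈ oddIndices a, (kappa a r n j : ℂ) * riemannZeta (j : ℂ) := by
  set Z : ℕ → ℕ → ℂ := fun i N => ∑ k ∈ range N, 1 / ((k : ℂ) + 1) ^ i with hZ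
  set T : ℕ → ℕ → ℕ → ℂ := fun i h N => ∑ s ∈ range h, 1 / (((N + s : ℕ) : ℂ) + 1) ^ i with hT
  have hpart : ∀ N, ∑ k ∈ range N, term a r n 1 k =
      (kappa a r n 0 : ℂ) + ∑ j ∈ oddIndices a, (kappa a r n j : ℂ) * Z j N +
        ∑ i ∈ Icc 1 a, ∑ h ∈ range (n + 1), (coef a r n i h : ℂ) * T i h N := by
    intro N
    have h1 : ∑ k ∈ range N, term a r n 1 k = ∑ i ∈ Icc 1 a, ∑ h ∈ range (n + 1),
        (coef a r n i h : ℂ) * (Z i N + T i h N - ∑ s ∈ range h, 1 / ((s : ℂ) + 1) ^ i) := by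
      have h2 : ∀ k ∈ range N, term a r n 1 k = ∑ i ∈ Icc 1 a, ∑ h ∈ range (n + 1),
          (coef a r n i h : ℂ) * (1 / (((h + k : ℕ) : ℂ) + 1) ^ i) := by
        intro k _
        rw [term, R_eq_sum hr hra, one_pow, inv_one, mul_one]
        · refine sum_congr rfl fun i _ => sum_congr rfl fun h _ => ?_
          rw [mul_one_div]
          congr 2
          push_cast
          ring
        · intro j _
          exact_mod_cast (by omega : k + 1 + j ≠ 0)
      rw [sum_congr rfl h2, sum_comm]
      refine sum_congr rfl fun i _ => ?_
      rw [sum_comm]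
      refine sum_congr rfl fun h _ => ?_
      rw [← mul_sum, sum_range_shift (fun k => 1 / ((k : ℂ) + 1) ^ i)]
    have h2 : ∑ j ∈ oddIndices a, (kappa a r n j : ℂ) * Z j N =
        ∑ i ∈ Icc 1 a, ∑ h ∈ range (n + 1), (coef a r n i h : ℂ) * Z i N := by
      have h3 : oddIndices a ⊆ Icc 1 a := by
        intro j hj
        simp only [oddIndices, mem_filter, mem_Icc] at hj ⊢
        omega
      rw [← sum_subset h3]
      · refine sum_congr rfl fun j hj => ?_
        have hj0 : j ≠ 0 := by
          simp only [oddIndices, mem_filter, mem_Icc] at hj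
          omega
        rw [kappa, if_neg hj0, Rat.cast_sum, sum_mul]
      · intro i hi hni
        rw [← sum_mul, ← Rat.cast_sum]
        have hzero : ∑ h ∈ range (n + 1), coef a r n i h = 0 := by
          rcases Nat.even_or_odd i with he | ho
          · exact sum_coef_eq_zero_of_even ha (mem_Icc.1 hi).2 he
          · have hi1 : i = 1 := by
              by_contra hne
              apply hni
              obtain ⟨t, ht⟩ := ho
              obtain ⟨u, hu⟩ := ha
              simp only [oddIndices, mem_filter, mem_Icc] at hi ⊢
              omega
            rw [hi1]
            exact sum_coef_one hr hra
        rw [hzero, Rat.cast_zero, zero_mul]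
    have h3 : (kappa a r n 0 : ℂ) = -∑ i ∈ Icc 1 a, ∑ h ∈ range (n + 1),
        (coef a r n i h : ℂ) * ∑ s ∈ range h, 1 / ((s : ℂ) + 1) ^ i := by
      rw [kappa, if_pos rfl]
      push_cast
      rfl
    rw [h1, h2, h3]
    simp only [mul_sub, mul_add, sum_sub_distrib, sum_add_distrib]
    ring
  have hlim1 : ∀ j ∈ oddIndices a, Tendsto (fun N => (kappa a r n j : ℂ) * Z j N) atTop
      (𝓝 ((kappa a r n j : ℂ) * riemannZeta j)) := by
    intro j hj
    refine (tendsto_partial_zeta ?_).const_mul _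
    simp only [oddIndices, mem_filter, mem_Icc] at hj
    omega
  have hlim2 : Tendsto (fun N => ∑ i ∈ Icc 1 a, ∑ h ∈ range (n + 1),
      (coef a r n i h : ℂ) * T i h N) atTop (𝓝 0) := by
    rw [show (0 : ℂ) = ∑ i ∈ Icc 1 a, ∑ h ∈ range (n + 1), (coef a r n i h : ℂ) *
      ∑ s ∈ range h, (0 : ℂ) by simp]
    refine tendsto_finsetSum _ fun i hi => tendsto_finsetSum _ fun h _ => ?_
    refine (tendsto_finsetSum _ fun s _ => ?_).const_mul _
    exact tendsto_inv_pow_zero (mem_Icc.1 hi).1 s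
  have hlim := ((tendsto_finsetSum _ hlim1).const_add (kappa a r n 0 : ℂ)).add hlim2
  rw [add_zero] at hlim
  exact tendsto_nhds_unique hs.hasSum.tendsto_sum_nat (hlim.congr fun N => (hpart N).symm)

/-! ### Positivity and convergence of the series -/

/-- The real number `R_n(k)`. -/
noncomputable def realTerm (a r n k : ℕ) : ℝ :=
  (2 * k + n) * (n.factorial : ℝ) ^ (a - 2 * r) *
    ((∏ i ∈ range (r * n), ((k : ℝ) - (i + 1))) * ∏ i ∈ range (r * n), ((k : ℝ) + n + 1 + i)) /
    (∏ i ∈ range (n + 1), ((k : ℝ) + i)) ^ a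

theorem term_one_eq (a r n k : ℕ) : term a r n 1 k = (realTerm a r n (k + 1) : ℂ) := by
  rw [term, R, ← aeval_numer, realTerm, one_pow, inv_one, mul_one, ascPochhammer_eval_eq_prod,
    numer]
  simp only [map_mul, map_prod, map_add, map_sub, Polynomial.aeval_X, map_pow,
    map_natCast, map_ofNat]
  push_cast
  congr 1
  rw [mul_assoc _ (∏ i ∈ range (r * n), _) (∏ i ∈ range (r * n), _), mul_comm (2 * ((k : ℂ) + 1) + n)]
  congr 2
  refine prod_congr rfl fun i _ => ?_
  ring

theorem realTerm_eq_zero {a r n k : ℕ} (hk : 1 ≤ k) (hkn : k ≤ r * n) : realTerm a r n k = 0 := by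
  have : ∏ i ∈ range (r * n), ((k : ℝ) - (i + 1)) = 0 := by
    refine prod_eq_zero (mem_range.2 (by omega : k - 1 < r * n)) ?_
    rw [Nat.cast_sub hk]
    push_cast
    ring
  rw [realTerm, this]
  simp

theorem realTerm_pos {a r n k : ℕ} (hkn : r * n < k) : 0 < realTerm a r n k := by
  have hk : (0 : ℝ) < k := by exact_mod_cast (by omega : 0 < k)
  have h1 : 0 < ∏ i ∈ range (r * n), ((k : ℝ) - (i + 1)) := by
    refine prod_pos fun i hi => ?_
    have : (i : ℝ) + 1 < k := by exact_mod_cast (by have := mem_range.1 hi; omega : i + 1 < k)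
    linarith
  have h2 : 0 < ∏ i ∈ range (r * n), ((k : ℝ) + n + 1 + i) := prod_pos fun i _ => by positivity
  have h3 : 0 < ∏ i ∈ range (n + 1), ((k : ℝ) + i) := prod_pos fun i _ => by positivity
  have hf : (0 : ℝ) < n.factorial := by exact_mod_cast n.factorial_pos
  rw [realTerm]
  positivity

theorem realTerm_nonneg {a r n k : ℕ} (hk : 1 ≤ k) : 0 ≤ realTerm a r n k := by
  rcases le_or_gt k (r * n) with h | h
  · exact (realTerm_eq_zero hk h).ge
  · exact (realTerm_pos h).le

/-- Pairing symmetric factors gives `(k - i - 1)(k + n + 1 + i) ≤ k(k + n) ≤ (k + i)(k + n - i)`, so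
`2r` powers of the denominator absorb the numerator products. The other `a - 2r` powers are compared
with `n! ≤ n ^ n`, and `2k + n ≤ 3k` gives the constant. The spare powers of `k` leave `1 / k ^ 2`
since `a ≥ 3`. -/
theorem realTerm_le {a r n k : ℕ} (hr : 1 ≤ r) (hra : 2 * r < a) (hk : 1 ≤ k) :
    realTerm a r n k ≤ 3 * (((n : ℝ) / k) ^ (a - 2 * r)) ^ n / (k : ℝ) ^ 2 := by
  have hk1 : (1 : ℝ) ≤ k := by exact_mod_cast hk
  have hk0 : (0 : ℝ) < k := by linarith
  rcases le_or_gt k (r * n) with h | h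
  · rw [realTerm_eq_zero hk h]
    positivity
  have hnk : (n : ℝ) ≤ k := by
    exact_mod_cast (le_trans (Nat.le_mul_of_pos_left n hr) h.le)
  have hn0 : (0 : ℝ) ≤ n := Nat.cast_nonneg n
  obtain ⟨e, rfl⟩ : ∃ e, a = 2 * r + (e + 1) := ⟨a - 2 * r - 1, by omega⟩
  rw [Nat.add_sub_cancel_left]
  set D := ∏ i ∈ range (n + 1), ((k : ℝ) + i) with hD
  have hnum : (∏ i ∈ range (r * n), ((k : ℝ) - (i + 1))) *
      ∏ i ∈ range (r * n), ((k : ℝ) + n + 1 + i) ≤ ((k : ℝ) * (k + n)) ^ (r * n) := by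
    rw [← prod_mul_distrib]
    refine (prod_le_prod (g := fun _ => (k : ℝ) * (k + n)) (fun i hi => ?_) fun i hi => ?_).trans
      (by simp)
    · have : (i : ℝ) + 1 < k := by exact_mod_cast (by have := mem_range.1 hi; omega : i + 1 < k)
      have : 0 ≤ (k : ℝ) - (i + 1) := by linarith
      positivity
    · nlinarith [Nat.cast_nonneg (α := ℝ) i]
  have hDsq : ((k : ℝ) * (k + n)) ^ (n + 1) ≤ D ^ 2 := by
    have h1 : D = ∏ i ∈ range (n + 1), ((k : ℝ) + (n - i)) := by
      rw [hD, ← prod_range_reflect]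
      refine prod_congr rfl fun i hi => ?_
      rw [Nat.add_sub_cancel, Nat.cast_sub (Nat.lt_succ_iff.1 (mem_range.1 hi))]
    rw [sq]
    nth_rw 2 [h1]
    rw [hD, ← prod_mul_distrib]
    refine le_trans (by simp) (prod_le_prod (f := fun _ => (k : ℝ) * (k + n)) (fun i _ => by positivity)
      fun i hi => ?_)
    have : (i : ℝ) ≤ n := by exact_mod_cast Nat.lt_succ_iff.1 (mem_range.1 hi)
    nlinarith [mul_nonneg (Nat.cast_nonneg (α := ℝ) i) (sub_nonneg.2 this)]
  have hDk : (k : ℝ) ^ (n + 1) ≤ D := by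
    refine le_trans (by simp) (prod_le_prod (f := fun _ => (k : ℝ)) (fun i _ => hk0.le)
      fun i _ => by linarith [Nat.cast_nonneg (α := ℝ) i])
  have hfac : (n.factorial : ℝ) ≤ (n : ℝ) ^ n := by exact_mod_cast n.factorial_le_pow
  have hD0 : 0 < D := lt_of_lt_of_le (by positivity) hDk
  have hDa : ((k : ℝ) * (k + n)) ^ (r * n) * (k ^ 2) ^ r * (k ^ (n + 1)) ^ (e + 1) ≤
      D ^ (2 * r + (e + 1)) := by
    have hsplit : D ^ (2 * r + (e + 1)) = (D ^ 2) ^ r * D ^ (e + 1) := by rw [pow_add, pow_mul]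
    rw [hsplit]
    refine mul_le_mul ?_ (by gcongr) (by positivity) (by positivity)
    calc ((k : ℝ) * (k + n)) ^ (r * n) * (k ^ 2) ^ r ≤
        ((k : ℝ) * (k + n)) ^ (r * n) * (k * (k + n)) ^ r := by
          gcongr
          nlinarith
      _ = (((k : ℝ) * (k + n)) ^ (n + 1)) ^ r := by rw [← pow_add, ← pow_mul]; congr 1; ring
      _ ≤ _ := by gcongr
  rw [realTerm, Nat.add_sub_cancel_left]
  calc _ ≤ (3 * (k : ℝ)) * ((n : ℝ) ^ n) ^ (e + 1) * (k * (k + n)) ^ (r * n) /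
        (((k : ℝ) * (k + n)) ^ (r * n) * (k ^ 2) ^ r * (k ^ (n + 1)) ^ (e + 1)) := by
        have hp : 0 ≤ (∏ i ∈ range (r * n), ((k : ℝ) - (i + 1))) *
            ∏ i ∈ range (r * n), ((k : ℝ) + n + 1 + i) := by
          refine mul_nonneg (prod_nonneg fun i hi => ?_) (prod_nonneg fun i _ => by positivity)
          have : (i : ℝ) + 1 < k := by
            exact_mod_cast (by have := mem_range.1 hi; omega : i + 1 < k)
          linarith
        gcongr
        linarith
    _ = 3 * (((n : ℝ) / k) ^ (e + 1)) ^ n * (k / ((k ^ 2) ^ r * k ^ (e + 1))) := by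
        have : (0 : ℝ) < k + n := by linarith
        rw [div_pow, div_pow]
        field_simp
        ring
    _ ≤ 3 * (((n : ℝ) / k) ^ (e + 1)) ^ n * (1 / k ^ 2) := by
        refine mul_le_mul_of_nonneg_left ?_ (by positivity)
        rw [div_le_div_iff₀ (by positivity) (by positivity), one_mul, ← pow_mul, ← pow_add,
          ← pow_succ']
        exact pow_le_pow_right₀ hk1 (by omega)
    _ = _ := by ring

theorem summable_one_div_succ_sq : Summable fun k : ℕ => 1 / ((k + 1 : ℕ) : ℝ) ^ 2 :=
  (summable_nat_add_iff 1).2 (Real.summable_one_div_nat_pow.2 one_lt_two)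

theorem realTerm_le_of_r {a r n : ℕ} (hr : 1 ≤ r) (hra : 2 * r < a) (k : ℕ) :
    realTerm a r n (k + 1) ≤ 3 * ((1 / (r : ℝ)) ^ (a - 2 * r)) ^ n * (1 / ((k + 1 : ℕ) : ℝ) ^ 2) := by
  have hr0 : (0 : ℝ) < r := by exact_mod_cast hr
  rcases le_or_gt (k + 1) (r * n) with h | h
  · rw [realTerm_eq_zero (by omega) h]
    positivity
  refine (realTerm_le hr hra (by omega)).trans ?_
  rw [mul_one_div]
  have : (n : ℝ) / ((k + 1 : ℕ) : ℝ) ≤ 1 / r := by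
    rw [div_le_div_iff₀ (by positivity) hr0, one_mul, mul_comm]
    exact_mod_cast h.le
  gcongr

theorem summable_realTerm {a r n : ℕ} (hr : 1 ≤ r) (hra : 2 * r < a) :
    Summable fun k => realTerm a r n (k + 1) :=
  Summable.of_nonneg_of_le (fun _ => realTerm_nonneg (by omega)) (realTerm_le_of_r hr hra)
    (summable_one_div_succ_sq.mul_left _)

theorem summable_term {a r n : ℕ} (hr : 1 ≤ r) (hra : 2 * r < a) :
    Summable (term a r n 1) := by
  have := Complex.ofRealCLM.summable (summable_realTerm (n := n) hr hra)
  refine this.congr fun k => ?_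
  rw [term_one_eq]
  rfl

theorem norm_S_eq (a r n : ℕ) : ‖S a r n 1‖ = ∑' k, realTerm a r n (k + 1) := by
  have h : S a r n 1 = ((∑' k, realTerm a r n (k + 1) : ℝ) : ℂ) := by
    rw [S, Complex.ofReal_tsum]
    exact tsum_congr fun k => term_one_eq a r n k
  rw [h, Complex.norm_real, Real.norm_of_nonneg (tsum_nonneg fun k => realTerm_nonneg (by omega))]

/-! ### Exponential rate of a single term -/

/-- The exponential rate of `R_n(x n)`. -/
noncomputable def rate (a r : ℕ) (x : ℝ) : ℝ :=
  (a + 1) * (x * Real.log x) + (x + r + 1) * Real.log (x + r + 1) - (x - r) * Real.log (x - r) -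
    (a + 1) * ((x + 1) * Real.log (x + 1))

theorem continuous_rate (a r : ℕ) : Continuous (rate a r) := by
  have h := Real.continuous_mul_log
  have h1 : Continuous fun x : ℝ => (x + r + 1) * Real.log (x + r + 1) :=
    h.comp (f := fun x : ℝ => x + r + 1) (by fun_prop)
  have h2 : Continuous fun x : ℝ => (x - r) * Real.log (x - r) :=
    h.comp (f := fun x : ℝ => x - r) (by fun_prop)
  have h3 : Continuous fun x : ℝ => (x + 1) * Real.log (x + 1) :=
    h.comp (f := fun x : ℝ => x + 1) (by fun_prop)
  exact (((h.const_mul _).add h1).sub h2).sub (h3.const_mul _)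

/-- A crude Stirling formula suffices: a logarithmic error is a polynomial factor, which disappears
under `n`-th roots. -/
theorem log_factorial_bounds (m : ℕ) :
    0 ≤ Real.log m.factorial - (m * Real.log m - m) ∧
      Real.log m.factorial - (m * Real.log m - m) ≤ 1 + Real.log (m + 1) := by
  have key : ∀ m : ℕ, 0 ≤ Real.log (m + 1).factorial - ((m + 1 : ℕ) * Real.log (m + 1 : ℕ) - (m + 1 : ℕ)) ∧
      Real.log (m + 1).factorial - ((m + 1 : ℕ) * Real.log (m + 1 : ℕ) - (m + 1 : ℕ)) ≤
        1 + Real.log (m + 1 : ℕ) := by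
    intro m
    induction m with
    | zero => simp
    | succ m ih =>
      have hx : (0 : ℝ) < (m + 1 : ℕ) := by positivity
      have hf : ((m + 1).factorial : ℝ) ≠ 0 := by exact_mod_cast (m + 1).factorial_ne_zero
      have hx1 : ((m + 1 + 1 : ℕ) : ℝ) = (m + 1 : ℕ) + 1 := by push_cast; ring
      rw [Nat.factorial_succ (m + 1), Nat.cast_mul, Real.log_mul (by positivity) hf, hx1]
      set x : ℝ := ((m + 1 : ℕ) : ℝ)
      have h1 : Real.log (x + 1) - Real.log x ≤ 1 / x := by
        rw [← Real.log_div (by positivity) hx.ne']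
        refine (Real.log_le_sub_one_of_pos (by positivity)).trans (le_of_eq ?_)
        field_simp
        ring
      have h2 : 1 / (x + 1) ≤ Real.log (x + 1) - Real.log x := by
        rw [← Real.log_div (by positivity) hx.ne']
        refine le_trans (le_of_eq ?_) (Real.one_sub_inv_le_log_of_pos (by positivity))
        field_simp
        ring
      have h1' : x * (Real.log (x + 1) - Real.log x) ≤ 1 := by
        calc _ ≤ x * (1 / x) := by gcongr
          _ = 1 := by field_simp
      have h2' : 1 ≤ (x + 1) * (Real.log (x + 1) - Real.log x) := by
        calc 1 = (x + 1) * (1 / (x + 1)) := by field_simp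
          _ ≤ _ := by gcongr
      constructor <;> nlinarith [ih.1, ih.2]
  rcases m with _ | m
  · simp
  · refine ⟨(key m).1, (key m).2.trans ?_⟩
    gcongr
    push_cast
    linarith

theorem realTerm_eq_factorial (a r n l : ℕ) :
    realTerm a r n (r * n + l + 1) =
      (2 * (r * n + l + 1 : ℕ) + n) * (n.factorial : ℝ) ^ (a - 2 * r) *
        ((r * n + l).factorial / l.factorial *
          ((r * n + l + 1 + n + r * n).factorial / (r * n + l + 1 + n).factorial)) /
        ((r * n + l + 1 + n).factorial / (r * n + l).factorial : ℝ) ^ a := by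
  have hf : ∀ m : ℕ, (m.factorial : ℝ) ≠ 0 := fun m => by exact_mod_cast m.factorial_ne_zero
  have h1 : ∏ i ∈ range (r * n), (((r * n + l + 1 : ℕ) : ℝ) - (i + 1)) =
      (r * n + l).factorial / l.factorial := by
    rw [eq_div_iff (hf l), ← Nat.factorial_mul_descFactorial (Nat.le_add_right (r * n) l),
      Nat.add_sub_cancel_left, Nat.descFactorial_eq_prod_range, mul_comm]
    push_cast
    congr 1
    refine prod_congr rfl fun i hi => ?_
    rw [Nat.cast_sub (by have := mem_range.1 hi; omega)]
    push_cast
    ring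
  have h2 : ∏ i ∈ range (r * n), (((r * n + l + 1 : ℕ) : ℝ) + n + 1 + i) =
      (r * n + l + 1 + n + r * n).factorial / (r * n + l + 1 + n).factorial := by
    rw [eq_div_iff (hf _), ← Nat.factorial_mul_ascFactorial (r * n + l + 1 + n) (r * n), Nat.ascFactorial_eq_prod_range,
      mul_comm]
    push_cast
    rfl
  have h3 : ∏ i ∈ range (n + 1), (((r * n + l + 1 : ℕ) : ℝ) + i) =
      (r * n + l + 1 + n).factorial / (r * n + l).factorial := by
    rw [eq_div_iff (hf _), show r * n + l + 1 + n = r * n + l + (n + 1) by ring,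
      ← Nat.factorial_mul_ascFactorial (r * n + l) (n + 1), Nat.ascFactorial_eq_prod_range, mul_comm]
    push_cast
    rfl
  rw [realTerm, h1, h2, h3]

theorem log_factorial_eq_sub (m : ℕ) :
    Real.log m.factorial = Real.log (m + 1).factorial - Real.log (m + 1) := by
  rw [Nat.factorial_succ, Nat.cast_mul, Real.log_mul (by positivity) (by
    exact_mod_cast m.factorial_ne_zero)]
  push_cast
  ring

theorem log_realTerm {a r n k : ℕ} (hk : r * n < k) :
    Real.log (realTerm a r n k) = Real.log (2 * k + n) - (a + 1) * Real.log k +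
      Real.log (k - r * n) + (a - 2 * r : ℕ) * Real.log n.factorial +
      (a + 1) * Real.log k.factorial - Real.log (k - r * n).factorial +
      Real.log (k + n + r * n).factorial - (a + 1) * Real.log (k + n).factorial := by
  obtain ⟨l, rfl⟩ : ∃ l, k = r * n + l + 1 := ⟨k - r * n - 1, by omega⟩
  have hf : ∀ m : ℕ, (m.factorial : ℝ) ≠ 0 := fun m => by exact_mod_cast m.factorial_ne_zero
  have h2 : (2 * ((r * n + l + 1 : ℕ) : ℝ) + n) ≠ 0 := by positivity
  have hsub : r * n + l + 1 - r * n = l + 1 := by omega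
  have hsub' : ((r * n + l + 1 : ℕ) : ℝ) - r * n = l + 1 := by push_cast; ring
  rw [realTerm_eq_factorial, Real.log_div (by simp [hf]; exact_mod_cast h2) (by simp [hf]),
    Real.log_mul (mul_ne_zero h2 (pow_ne_zero _ (hf _))) (by simp [hf]),
    Real.log_mul h2 (pow_ne_zero _ (hf _)), Real.log_mul (by simp [hf]) (by simp [hf]),
    Real.log_div (hf _) (hf _), Real.log_div (hf _) (hf _), Real.log_pow, Real.log_pow,
    Real.log_div (hf _) (hf _), log_factorial_eq_sub (r * n + l), log_factorial_eq_sub l, hsub,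
    hsub']
  push_cast
  ring

theorem mul_log_scale {n x : ℝ} (hn : 0 < n) :
    x * Real.log x = n * (x / n * Real.log (x / n)) + x * Real.log n := by
  rcases eq_or_ne x 0 with rfl | hx
  · simp
  · rw [Real.log_div hx hn.ne']
    field_simp
    ring

/-- After Stirling, the terms in `n * log n` and the linear terms cancel, thanks to the normalising
power `a - 2r` of `n!`. The remaining logarithms and Stirling errors are each at most `Λ`, and their
weights total at most `2a + 5` on either side. -/
theorem abs_log_realTerm_sub_le {a r n k : ℕ} (hra : 2 * r < a) (hn : 1 ≤ n) (hk : r * n < k) :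
    |Real.log (realTerm a r n k) - n * rate a r (k / n)| ≤
      (2 * a + 5) * (1 + Real.log (k + n + r * n + 1)) := by
  have hn0 : (0 : ℝ) < n := by exact_mod_cast hn
  have hn1 : (1 : ℝ) ≤ n := by exact_mod_cast hn
  have hk1 : (1 : ℝ) ≤ k := by exact_mod_cast (by omega : 1 ≤ k)
  have hkr : (r : ℝ) * n + 1 ≤ k := by exact_mod_cast hk
  have hrn : (0 : ℝ) ≤ r * n := by positivity
  set Λ : ℝ := 1 + Real.log (k + n + r * n + 1) with hΛ
  have hmono : ∀ x : ℝ, 0 < x → x ≤ k + n + r * n + 1 → 1 + Real.log x ≤ Λ := by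
    intro x hx hxle
    have := Real.log_le_log hx hxle
    linarith
  have hE : ∀ m : ℕ, (m : ℝ) ≤ k + n + r * n →
      0 ≤ Real.log m.factorial - (m * Real.log m - m) ∧
      Real.log m.factorial - (m * Real.log m - m) ≤ Λ := by
    intro m hm
    have h := log_factorial_bounds m
    exact ⟨h.1, h.2.trans (hmono _ (by positivity) (by linarith))⟩
  have hΛ1 : 1 ≤ Λ := by
    have : 0 ≤ Real.log (k + n + r * n + 1) := Real.log_nonneg (by linarith)
    linarith
  have hsub : ((k - r * n : ℕ) : ℝ) = k - r * n := by
    rw [Nat.cast_sub hk.le]; push_cast; ring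
  obtain ⟨e1, e1'⟩ := hE n (by linarith)
  obtain ⟨e2, e2'⟩ := hE k (by linarith)
  obtain ⟨e3, e3'⟩ := hE (k - r * n) (by rw [hsub]; linarith)
  obtain ⟨e4, e4'⟩ := hE (k + n + r * n) (by push_cast; exact le_rfl)
  obtain ⟨e5, e5'⟩ := hE (k + n) (by push_cast; linarith)
  rw [hsub] at e3 e3'
  push_cast at e4 e4' e5 e5'
  have l1 : 0 ≤ Real.log (2 * k + n) := Real.log_nonneg (by linarith)
  have l1' : Real.log (2 * k + n) ≤ Λ := by
    have h2 : Real.log (2 * k + n) ≤ Real.log (2 * (k + n + r * n + 1)) :=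
      Real.log_le_log (by linarith) (by linarith)
    rw [Real.log_mul (by norm_num) (by linarith)] at h2
    have h3 : Real.log 2 ≤ 1 := by
      have := Real.log_two_lt_d9; linarith
    linarith
  have l2 : 0 ≤ Real.log k := Real.log_nonneg hk1
  have l2' : Real.log k ≤ Λ := by
    have := hmono k (by linarith) (by linarith); linarith
  have l3 : 0 ≤ Real.log (k - r * n : ℝ) := Real.log_nonneg (by linarith)
  have l3' : Real.log (k - r * n : ℝ) ≤ Λ := by
    have := hmono (k - r * n) (by linarith) (by linarith); linarith
  obtain ⟨e, he⟩ : ∃ e, a - 2 * r = e := ⟨_, rfl⟩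
  have hea : (a : ℝ) = e + 2 * r := by
    exact_mod_cast (by omega : a = e + 2 * r)
  have hr0 : (0 : ℝ) ≤ r := Nat.cast_nonneg r
  have he0 : (0 : ℝ) ≤ e := Nat.cast_nonneg e
  have key : Real.log (realTerm a r n k) - n * rate a r (k / n) =
      Real.log (2 * k + n) - (a + 1) * Real.log k + Real.log (k - r * n) +
      e * (Real.log n.factorial - (n * Real.log n - n)) +
      (a + 1) * (Real.log k.factorial - (k * Real.log k - k)) -
      (Real.log (k - r * n).factorial - ((k - r * n) * Real.log (k - r * n) - (k - r * n))) +
      (Real.log (k + n + r * n).factorial -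
        ((k + n + r * n) * Real.log (k + n + r * n) - (k + n + r * n))) -
      (a + 1) * (Real.log (k + n).factorial - ((k + n) * Real.log (k + n) - (k + n))) := by
    rw [log_realTerm hk, he, rate, mul_log_scale (x := (k : ℝ)) hn0,
      mul_log_scale (x := (k - r * n : ℝ)) hn0, mul_log_scale (x := (k + n + r * n : ℝ)) hn0,
      mul_log_scale (x := (k + n : ℝ)) hn0]
    have d1 : (k + n + r * n : ℝ) / n = k / n + r + 1 := by field_simp; ring
    have d2 : (k - r * n : ℝ) / n = k / n - r := by field_simp
    have d3 : (k + n : ℝ) / n = k / n + 1 := by field_simp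
    rw [d1, d2, d3, hea]
    ring
  have m1 : 0 ≤ (a + 1 : ℝ) * Real.log k := by positivity
  have m1' : (a + 1 : ℝ) * Real.log k ≤ (a + 1) * Λ := by gcongr
  have m2 := mul_nonneg he0 e1
  have m2' := mul_le_mul_of_nonneg_left e1' he0
  have ha1 : (0 : ℝ) ≤ a + 1 := by positivity
  have m3 := mul_nonneg ha1 e2
  have m3' := mul_le_mul_of_nonneg_left e2' ha1
  have m5 := mul_nonneg ha1 e5
  have m5' := mul_le_mul_of_nonneg_left e5' ha1
  have m6 : (e : ℝ) * Λ ≤ a * Λ := by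
    refine mul_le_mul_of_nonneg_right ?_ (by linarith)
    linarith
  rw [key, abs_le]
  constructor <;> linarith

/-- The polynomial factor separating `R_n(k)` from its exponential rate for `k ≤ K n`. -/
noncomputable def envelope (a r K n : ℕ) : ℝ :=
  (Real.exp 1 * (K + r + 2)) ^ (2 * a + 5) * ((n : ℝ) + 1) ^ (2 * a + 5)

theorem realTerm_envelope {a r n k K : ℕ} (hra : 2 * r < a) (hn : 1 ≤ n) (hk : r * n < k)
    (hkK : k ≤ K * n) :
    realTerm a r n k ≤ envelope a r K n * Real.exp (rate a r (k / n)) ^ n ∧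
      (envelope a r K n)⁻¹ * Real.exp (rate a r (k / n)) ^ n ≤ realTerm a r n k := by
  have h := abs_log_realTerm_sub_le hra hn hk
  have hkK' : (k : ℝ) ≤ K * n := by exact_mod_cast hkK
  have hX : (0 : ℝ) < k + n + r * n + 1 := by positivity
  have henv : Real.exp ((2 * a + 5) * (1 + Real.log (k + n + r * n + 1))) ≤ envelope a r K n := by
    have h1 : Real.exp ((2 * a + 5) * (1 + Real.log (k + n + r * n + 1))) =
        (Real.exp 1 * (k + n + r * n + 1)) ^ (2 * a + 5) := by
      have : ((2 * a + 5 : ℕ) : ℝ) = 2 * a + 5 := by push_cast; ring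
      rw [← this, Real.exp_nat_mul, Real.exp_add, Real.exp_log hX]
    rw [h1, envelope, ← mul_pow, mul_assoc]
    gcongr
    have : (0 : ℝ) ≤ K + r := by positivity
    nlinarith
  have hpos := realTerm_pos (a := a) hk
  rw [← Real.exp_nat_mul]
  rw [abs_le] at h
  have henv0 : 0 < envelope a r K n := lt_of_lt_of_le (Real.exp_pos _) henv
  constructor
  · rw [← Real.exp_log hpos]
    refine le_trans ?_ (mul_le_mul_of_nonneg_right henv (Real.exp_pos _).le)
    rw [← Real.exp_add]
    exact Real.exp_le_exp.2 (by linarith [h.2])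
  · rw [inv_mul_le_iff₀ henv0]
    conv_rhs => rw [← Real.exp_log hpos]
    refine le_trans ?_ (mul_le_mul_of_nonneg_right henv (Real.exp_pos _).le)
    rw [← Real.exp_add]
    exact Real.exp_le_exp.2 (by linarith [h.1])

/-! ### Asymptotics of `S_n(1)` -/

theorem exists_rate_max {a r : ℕ} (hra : 2 * r < a) :
    ∃ K : ℕ, ∃ x₀ : ℝ, 1 ≤ K ∧ (r : ℝ) ≤ x₀ ∧ x₀ ≤ K ∧
      (∀ x : ℝ, (r : ℝ) ≤ x → x ≤ K → rate a r x ≤ rate a r x₀) ∧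
      (1 / (K : ℝ)) ^ (a - 2 * r) ≤ Real.exp (rate a r x₀) := by
  obtain ⟨K₀, hK₀⟩ := exists_nat_ge (Real.exp (-rate a r r))
  -- `K` is so large that `1 / K ≤ exp (rate r)`. The terms with `k > K n`, bounded by
  -- `realTerm_le`, then cannot exceed the exponential of the maximum over the compact interval `[r,
  -- K]`.
  set K := max K₀ (r + 1) with hKdef
  have hrK : (r : ℝ) ≤ K := by exact_mod_cast (by omega : r ≤ K)
  have hK1 : 1 ≤ K := by omega
  obtain ⟨x₀, hx₀, hmax⟩ := isCompact_Icc.exists_isMaxOn (Set.nonempty_Icc.2 hrK)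
    (continuous_rate a r).continuousOn
  refine ⟨K, x₀, hK1, hx₀.1, hx₀.2, fun x h1 h2 => hmax ⟨h1, h2⟩, ?_⟩
  have hK1' : (1 : ℝ) ≤ K := by exact_mod_cast hK1
  have hle : (1 / (K : ℝ)) ≤ 1 := by rw [div_le_one (by linarith)]; exact hK1'
  calc (1 / (K : ℝ)) ^ (a - 2 * r) ≤ 1 / (K : ℝ) :=
        pow_le_of_le_one (by positivity) hle (by omega)
    _ ≤ 1 / Real.exp (-rate a r r) := by
        refine one_div_le_one_div_of_le (Real.exp_pos _) (hK₀.trans ?_)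
        exact_mod_cast le_max_left _ _
    _ = Real.exp (rate a r r) := by rw [Real.exp_neg, one_div, inv_inv]
    _ ≤ _ := Real.exp_le_exp.2 (hmax ⟨le_rfl, hrK⟩)

theorem tendsto_root_norm_S {a r : ℕ} (hr : 1 ≤ r) (hra : 2 * r < a) :
    ∃ ψ : ℝ, 0 < ψ ∧ Tendsto (fun n : ℕ => ‖S a r n 1‖ ^ (1 / (n : ℝ))) atTop (𝓝 ψ) := by
  obtain ⟨K, x₀, hK1, hrx, hxK, hmax, htail⟩ := exists_rate_max hra
  refine ⟨Real.exp (rate a r x₀), Real.exp_pos _, ?_⟩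
  set ψ := Real.exp (rate a r x₀)
  have hψ : 0 < ψ := Real.exp_pos _
  have hx0 : 0 ≤ x₀ := (Nat.cast_nonneg r).trans hrx
  set Z : ℝ := ∑' k : ℕ, 1 / ((k + 1 : ℕ) : ℝ) ^ 2 with hZ
  have hZ0 : 0 < Z := summable_one_div_succ_sq.tsum_pos (fun _ => by positivity) 0 (by norm_num)
  set D := 2 * a + 5 with hD
  set A : ℝ := (Real.exp 1 * (K + r + 2)) ^ D with hA
  have hA0 : 0 < A := by positivity
  set A' : ℝ := (Real.exp 1 * ((K + 1 : ℕ) + r + 2)) ^ D with hA'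
  have hA'0 : 0 < A' := by positivity
  have hK1' : (1 : ℝ) ≤ K := by exact_mod_cast hK1
  have hterm : ∀ n : ℕ, 1 ≤ n → ∀ k : ℕ, realTerm a r n (k + 1) ≤
      ((A * K ^ 2 + 3) * ((n : ℝ) + 1) ^ (D + 2)) * ψ ^ n * (1 / ((k + 1 : ℕ) : ℝ) ^ 2) := by
    intro n hn k
    have hn0 : (0 : ℝ) < n := by exact_mod_cast hn
    have hk0 : (0 : ℝ) < ((k + 1 : ℕ) : ℝ) := by positivity
    have hn1 : (1 : ℝ) ≤ ((n : ℝ) + 1) ^ (D + 2) := one_le_pow₀ (by linarith)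
    rcases le_or_gt (k + 1) (r * n) with h | h
    · rw [realTerm_eq_zero (by omega) h]
      positivity
    rcases le_or_gt (k + 1) (K * n) with h' | h'
    · have h'' : ((k + 1 : ℕ) : ℝ) ≤ K * n := by exact_mod_cast h'
      have hrate : Real.exp (rate a r (((k + 1 : ℕ) : ℝ) / n)) ≤ ψ := by
        refine Real.exp_le_exp.2 (hmax _ ?_ ?_)
        · rw [le_div_iff₀ hn0]
          exact_mod_cast h.le
        · rw [div_le_iff₀ hn0]
          exact h''
      calc realTerm a r n (k + 1) ≤ envelope a r K n * ψ ^ n := by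
            refine (realTerm_envelope hra hn h h').1.trans ?_
            have : 0 ≤ envelope a r K n := by rw [envelope]; positivity
            gcongr
        _ = A * ((n : ℝ) + 1) ^ D * ψ ^ n * 1 := by rw [envelope, mul_one]
        -- In this range the summable weight `1 / (k + 1) ^ 2` is inserted at the cost of a
        -- polynomial factor, so that one bound serves all `k`.
        _ ≤ A * ((n : ℝ) + 1) ^ D * ψ ^ n * ((K * (n + 1)) ^ 2 * (1 / ((k + 1 : ℕ) : ℝ) ^ 2)) := by
            refine mul_le_mul_of_nonneg_left ?_ (by positivity)
            rw [mul_one_div, le_div_iff₀ (by positivity), one_mul]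
            gcongr
            nlinarith
        _ = (A * K ^ 2 * ((n : ℝ) + 1) ^ (D + 2)) * ψ ^ n * (1 / ((k + 1 : ℕ) : ℝ) ^ 2) := by ring
        _ ≤ _ := by gcongr; linarith
    · have h'' : (K : ℝ) * n ≤ ((k + 1 : ℕ) : ℝ) := by exact_mod_cast h'.le
      calc realTerm a r n (k + 1) ≤
            3 * (((n : ℝ) / (k + 1 : ℕ)) ^ (a - 2 * r)) ^ n / ((k + 1 : ℕ) : ℝ) ^ 2 :=
            realTerm_le hr hra (by omega)
        _ ≤ 3 * ψ ^ n / ((k + 1 : ℕ) : ℝ) ^ 2 := by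
            gcongr
            refine le_trans ?_ htail
            refine pow_le_pow_left₀ (by positivity) ?_ _
            rw [div_le_div_iff₀ hk0 (by linarith)]
            linarith
        _ = 3 * 1 * ψ ^ n * (1 / ((k + 1 : ℕ) : ℝ) ^ 2) := by ring
        _ ≤ _ := by
            gcongr
            have : 0 ≤ A * K ^ 2 := by positivity
            linarith
  have hupper : ∀ n : ℕ, 1 ≤ n → ‖S a r n 1‖ ^ (1 / (n : ℝ)) ≤
      (((A * K ^ 2 + 3) * Z) * ((n : ℝ) + 1) ^ (D + 2)) ^ (1 / (n : ℝ)) * ψ := by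
    intro n hn
    rw [← root_mul_pow (by positivity) hψ.le (by omega)]
    refine Real.rpow_le_rpow (norm_nonneg _) ?_ (by positivity)
    rw [norm_S_eq]
    refine ((summable_realTerm hr hra).tsum_le_tsum (hterm n hn)
      (summable_one_div_succ_sq.mul_left _)).trans (le_of_eq ?_)
    rw [tsum_mul_left, ← hZ]
    ring
  -- A single term bounds the sum from below. The index `kn n + 1` exceeds `r n` as `x₀ ≥ r`, and
  -- its ratio to `n` tends to `x₀`; it may pass `K n` by one, hence `K + 1` in `A'`.
  set kn : ℕ → ℕ := fun n => ⌊x₀ * n⌋₊ with hkn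
  have hlower : ∀ n : ℕ, 1 ≤ n →
      ((A' * ((n : ℝ) + 1) ^ D) ^ (1 / (n : ℝ)))⁻¹ *
        Real.exp (rate a r (((kn n + 1 : ℕ) : ℝ) / n)) ≤ ‖S a r n 1‖ ^ (1 / (n : ℝ)) := by
    intro n hn
    have hn0 : (0 : ℝ) < n := by exact_mod_cast hn
    have h1 : r * n < kn n + 1 := by
      refine Nat.lt_succ_of_le (Nat.le_floor ?_)
      push_cast
      gcongr
    have h2 : kn n + 1 ≤ (K + 1) * n := by
      have : kn n ≤ K * n := by
        refine Nat.floor_le_of_le ?_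
        push_cast
        gcongr
      nlinarith
    have h3 := (realTerm_envelope hra hn h1 h2).2
    rw [← Real.inv_rpow (by positivity), ← root_mul_pow (by positivity) (Real.exp_pos _).le (by omega)]
    refine Real.rpow_le_rpow (by positivity) ?_ (by positivity)
    rw [norm_S_eq]
    refine le_trans ?_ ((summable_realTerm hr hra).le_tsum (kn n)
      (fun _ _ => realTerm_nonneg (by omega)))
    exact h3
  have hlimk : Tendsto (fun n : ℕ => ((kn n + 1 : ℕ) : ℝ) / n) atTop (𝓝 x₀) := by
    have h1 := (tendsto_nat_floor_mul_div_atTop hx0).comp (tendsto_natCast_atTop_atTop (R := ℝ))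
    have h2 := h1.add (tendsto_one_div_atTop_nhds_zero_nat (𝕜 := ℝ))
    rw [add_zero] at h2
    refine h2.congr fun n => ?_
    simp only [Function.comp, hkn]
    push_cast
    ring
  have hlimlow := ((tendsto_root_poly hA'0 D).inv₀ one_ne_zero).mul
    ((Real.continuous_exp.tendsto _).comp (((continuous_rate a r).tendsto x₀).comp hlimk))
  have hlimup := (tendsto_root_poly (C := (A * K ^ 2 + 3) * Z) (by positivity) (D + 2)).mul_const ψ
  rw [inv_one, one_mul] at hlimlow
  rw [one_mul] at hlimup
  refine tendsto_of_tendsto_of_tendsto_of_le_of_le' hlimlow hlimup ?_ ?_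
  · filter_upwards [eventually_ge_atTop 1] with n hn using hlower n hn
  · filter_upwards [eventually_ge_atTop 1] with n hn using hupper n hn

theorem root_norm_S_limit_le {a r : ℕ} (hr : 1 ≤ r) (hra : 2 * r < a) {ψ : ℝ}
    (h : Tendsto (fun n : ℕ => ‖S a r n 1‖ ^ (1 / (n : ℝ))) atTop (𝓝 ψ)) :
    ψ ≤ 1 / (r : ℝ) ^ (a - 2 * r) := by
  set Z : ℝ := ∑' k : ℕ, 1 / ((k + 1 : ℕ) : ℝ) ^ 2 with hZ
  have hZ0 : 0 < Z := summable_one_div_succ_sq.tsum_pos (fun _ => by positivity) 0 (by norm_num)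
  have hlim := (tendsto_root_poly (C := 3 * Z) (by positivity) 0).mul_const
    ((1 / (r : ℝ)) ^ (a - 2 * r))
  rw [one_mul, one_div_pow] at hlim
  refine le_of_tendsto_of_tendsto h hlim ?_
  filter_upwards [eventually_ge_atTop 1] with n hn
  rw [← one_div_pow, ← root_mul_pow (by positivity) (by positivity) (by omega)]
  refine Real.rpow_le_rpow (norm_nonneg _) ?_ (by positivity)
  rw [norm_S_eq]
  refine ((summable_realTerm hr hra).tsum_le_tsum (realTerm_le_of_r hr hra)
    (summable_one_div_succ_sq.mul_left _)).trans (le_of_eq ?_)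
  rw [tsum_mul_left, ← hZ]
  ring

end VeryWellPoised

theorem mainTheorem7 (a r : ℕ) (ha : Even a) (hr : 1 ≤ r) (hra : 2 * r < a) :
    (∀ n : ℕ, 1 ≤ n → Summable (VeryWellPoised.term a r n 1)) ∧
    ∃ κ : ℕ → ℕ → ℚ,
      (∀ n : ℕ, 1 ≤ n →
        VeryWellPoised.S a r n 1 =
          (κ n 0 : ℂ) + ∑ j ∈ VeryWellPoised.oddIndices a, (κ n j : ℂ) * riemannZeta (j : ℂ)) ∧
      (∀ j ∈ insert 0 (VeryWellPoised.oddIndices a),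
        Filter.limsup (fun n : ℕ => ((|(κ n j : ℝ)| ^ (1 / (n : ℝ)) : ℝ) : EReal)) Filter.atTop ≤
          ((2 ^ (a - 2 * r) * (2 * (r : ℝ) + 1) ^ (2 * r + 1) : ℝ) : EReal)) ∧
      (∀ n : ℕ, 1 ≤ n → ∀ j ∈ insert 0 (VeryWellPoised.oddIndices a),
        ∃ m : ℤ, (VeryWellPoised.d n : ℚ) ^ a * κ n j = (m : ℚ)) ∧
      ∃ ψ : ℝ, 0 < ψ ∧
        Filter.Tendsto (fun n : ℕ => ‖VeryWellPoised.S a r n 1‖ ^ (1 / (n : ℝ)))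
          Filter.atTop (nhds ψ) ∧
        ψ ≤ 2 ^ (r + 1) / (r : ℝ) ^ (a - 2 * r) := by
  refine ⟨fun n _ => VeryWellPoised.summable_term hr hra, VeryWellPoised.kappa a r,
    fun n _ => VeryWellPoised.S_eq_of_summable ha hr hra (VeryWellPoised.summable_term hr hra),
    fun j _ => VeryWellPoised.limsup_kappa_le hra j, fun n _ j hj => ?_, ?_⟩
  · refine VeryWellPoised.d_pow_mul_kappa_integral hra ?_
    simp only [VeryWellPoised.oddIndices, Finset.mem_insert, Finset.mem_filter,
      Finset.mem_Icc] at hj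
    omega
  · obtain ⟨ψ, hψ, hlim⟩ := VeryWellPoised.tendsto_root_norm_S hr hra
    refine ⟨ψ, hψ, hlim, (VeryWellPoised.root_norm_S_limit_le hr hra hlim).trans ?_⟩
    -- The limit is at most `1 / r ^ (a - 2r)`, so the factor `2 ^ (r + 1)` is pure slack.
    gcongr
    exact one_le_pow₀ one_le_two
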